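/- Let $n\ge 2$, $R_1>0$, and write $B_R$ for the open ball of radius $R$ in $\mathbb R^n$ centred at the origin. For an open bounded set $\Omega_0\subset\mathbb R^n$ with Lipschitz boundary (for instance, convex) and $\overline{B}_{R_1}\subset\Omega_0$, put $\Omega=\Omega_0\setminus\overline{B}_{R_1}$, and let $H^1_{\partial B_{R_1}}(\Omega)$ be the closure in $H^1(\Omega)$ of $\{\varphi|_\Omega:\ \varphi\in C_c^\infty(\mathbb R^n),\ \operatorname{supp}\varphi\cap\partial B_{R_1}=\emptyset\}$. The first Steklov–Dirichlet eigenvalue of $\Omega$ is $$\sigma_1(\Omega)=\inf_{\substack{v\in H^1_{\partial B_{R_1}}(\Omega)\\ v\not\equiv 0}}\frac{\displaystyle\int_\Omega|\nabla v|^2\,dx}{\displaystyle\int_{\partial\Omega_0}v^2\,d\mathcal H^{n-1}},$$ where $v$ on $\partial\Omega_0$ is understood in the sense of traces and the quotient is $+\infty$ if the trace of $v$ on $\partial\Omega_0$ vanishes. Let $$\bar R=\begin{cases}R_1e^{\sqrt2}&\text{if }n=2,\\[1ex] R_1\left[\dfrac{(n-1)+(n-2)\sqrt{2(n-1)}}{n-1}\right]^{\frac1{n-2}}&\text{if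 }n\ge3.\end{cases}$$ **Theorem.** Let $\Omega_0\subset\mathbb R^n$ be an open bounded convex set with $\overline{B}_{R_1}\subset\Omega_0\subseteq B_{\bar R}$, and let $\Omega=\Omega_0\setminus\overline{B}_{R_1}$. Then $$\sigma_1(\Omega)\le\sigma_1(A_{R_1,R_2}),$$ where $A_{R_1,R_2}=\{x\in\mathbb R^n: R_1<|x|<R_2\}=B_{R_2}\setminus\overline{B}_{R_1}$, $R_2>R_1$, is the spherical shell with the same volume as $\Omega$. -/

import Mathlib

open MeasureTheory Filter Topology
open scoped ContDiff

noncomputable section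

namespace SteklovDirichlet

/-- `φ` belongs to `C_c^∞(ℝⁿ)`. -/
def IsTestFunction {n : ℕ} (φ : EuclideanSpace ℝ (Fin n) → ℝ) : Prop :=
  ContDiff ℝ ∞ φ ∧ HasCompactSupport φ

/-- `G` is the weak gradient of `u` in the open set `Ω`:
`∫_Ω u ∇φ = - ∫_Ω φ G` for all `φ ∈ C_c^∞(Ω)`. -/
def HasWeakGradient {n : ℕ} (Ω : Set (EuclideanSpace ℝ (Fin n)))
    (u : EuclideanSpace ℝ (Fin n) → ℝ)
    (G : EuclideanSpace ℝ (Fin n) → EuclideanSpace ℝ (Fin n)) : Prop :=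
  ∀ φ : EuclideanSpace ℝ (Fin n) → ℝ, IsTestFunction φ → tsupport φ ⊆ Ω →
    ∫ x in Ω, u x • gradient φ x = -∫ x in Ω, φ x • G x

/-- `u ∈ H¹(Ω)`, with weak gradient `G` (which `u` determines almost everywhere in `Ω`). -/
structure MemH1 {n : ℕ} (Ω : Set (EuclideanSpace ℝ (Fin n)))
    (u : EuclideanSpace ℝ (Fin n) → ℝ)
    (G : EuclideanSpace ℝ (Fin n) → EuclideanSpace ℝ (Fin n)) : Prop where
  memLp : MemLp u 2 (volume.restrict Ω)
  memLp_grad : MemLp G 2 (volume.restrict Ω)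
  weak_grad : HasWeakGradient Ω u G

/-- The restrictions to `Ω` of the smooth functions `φ k` converge in the norm of `H¹(Ω)` to the
function `u` with weak gradient `G`. -/
def TendstoH1 {n : ℕ} (Ω : Set (EuclideanSpace ℝ (Fin n)))
    (φ : ℕ → EuclideanSpace ℝ (Fin n) → ℝ) (u : EuclideanSpace ℝ (Fin n) → ℝ)
    (G : EuclideanSpace ℝ (Fin n) → EuclideanSpace ℝ (Fin n)) : Prop :=
  Tendsto (fun k => eLpNorm (fun x => φ k x - u x) 2 (volume.restrict Ω)) atTop (𝓝 0) ∧
  Tendsto (fun k => eLpNorm (fun x => gradient (φ k) x - G x) 2 (volume.restrict Ω)) atTop (𝓝 0)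

/-- `u ∈ H¹_Γ(Ω)`, with weak gradient `G`: the function `u` lies in the closure in `H¹(Ω)` of
`{φ|_Ω : φ ∈ C_c^∞(ℝⁿ), supp φ ∩ Γ = ∅}`. -/
structure MemH1Vanishing {n : ℕ} (Ω Γ : Set (EuclideanSpace ℝ (Fin n)))
    (u : EuclideanSpace ℝ (Fin n) → ℝ)
    (G : EuclideanSpace ℝ (Fin n) → EuclideanSpace ℝ (Fin n)) : Prop where
  memH1 : MemH1 Ω u G
  approx : ∃ φ : ℕ → EuclideanSpace ℝ (Fin n) → ℝ,
    (∀ k, IsTestFunction (φ k) ∧ tsupport (φ k) ∩ Γ = ∅) ∧ TendstoH1 Ω φ u G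

/-- The surface measure `𝓗ⁿ⁻¹` (with its Euclidean normalization) on `Γ ⊆ ℝⁿ`. -/
def surfaceMeasure {n : ℕ} (Γ : Set (EuclideanSpace ℝ (Fin n))) :
    Measure (EuclideanSpace ℝ (Fin n)) :=
  (Measure.euclideanHausdorffMeasure (n - 1)).restrict Γ

/-- `g ∈ L²(Γ)` is the trace on the boundary piece `Γ` of `u ∈ H¹(Ω)` (with weak gradient `G`).
The trace operator is the continuous extension to `H¹(Ω)` of the restriction
`φ|_Ω ↦ φ|_Γ`, `φ ∈ C_c^∞(ℝⁿ)`; accordingly, `g` is the limit in `L²(Γ, 𝓗ⁿ⁻¹)` of the restrictions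
of smooth functions which converge to `u` in `H¹(Ω)`. -/
def HasTrace {n : ℕ} (Ω Γ : Set (EuclideanSpace ℝ (Fin n)))
    (u : EuclideanSpace ℝ (Fin n) → ℝ)
    (G : EuclideanSpace ℝ (Fin n) → EuclideanSpace ℝ (Fin n))
    (g : EuclideanSpace ℝ (Fin n) → ℝ) : Prop :=
  MemLp g 2 (surfaceMeasure Γ) ∧
  ∃ φ : ℕ → EuclideanSpace ℝ (Fin n) → ℝ,
    (∀ k, IsTestFunction (φ k)) ∧ TendstoH1 Ω φ u G ∧
    Tendsto (fun k => eLpNorm (fun x => φ k x - g x) 2 (surfaceMeasure Γ)) atTop (𝓝 0)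

/-- The first Steklov–Dirichlet eigenvalue of `Ω`, with Dirichlet condition on `ΓD` and Steklov
condition on `ΓS`: the infimum of `∫_Ω |∇v|² / ∫_{ΓS} v² d𝓗ⁿ⁻¹` over all `v ∈ H¹_{ΓD}(Ω)`, `v ≢ 0`.
The functions `v` with zero trace on `ΓS` have quotient `+∞` and are left out. -/
def sigma1 {n : ℕ} (Ω ΓD ΓS : Set (EuclideanSpace ℝ (Fin n))) : ℝ :=
  sInf {q : ℝ | ∃ (v : EuclideanSpace ℝ (Fin n) → ℝ)
    (G : EuclideanSpace ℝ (Fin n) → EuclideanSpace ℝ (Fin n))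
    (g : EuclideanSpace ℝ (Fin n) → ℝ),
    MemH1Vanishing Ω ΓD v G ∧ ¬ (v =ᵐ[volume.restrict Ω] 0) ∧
    HasTrace Ω ΓS v G g ∧ ¬ (g =ᵐ[surfaceMeasure ΓS] 0) ∧
    q = (∫ x in Ω, ‖G x‖ ^ 2) / (∫ x, g x ^ 2 ∂(surfaceMeasure ΓS))}

/-- The spherical shell `A_{R₁,R₂} = {x ∈ ℝⁿ : R₁ < |x| < R₂}`. -/
def sphericalShell (n : ℕ) (R₁ R₂ : ℝ) : Set (EuclideanSpace ℝ (Fin n)) :=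
  {x | R₁ < ‖x‖ ∧ ‖x‖ < R₂}

/-- The radius `R̄` of the ball which has to contain the convex set. -/
def criticalRadius (n : ℕ) (R₁ : ℝ) : ℝ :=
  if n = 2 then R₁ * Real.exp (Real.sqrt 2)
  else R₁ * ((((n : ℝ) - 1) + ((n : ℝ) - 2) * Real.sqrt (2 * ((n : ℝ) - 1))) / ((n : ℝ) - 1))
    ^ (1 / ((n : ℝ) - 2))

end SteklovDirichlet

end

/-!
The competitor for `Ω` is the radial harmonic function `w(x) = W(‖x‖)`, where
`W(r) = ∫_{R₁}^r s^(1-n) ds` (`potential`); it realizes `σ₁` on the shell, and its Rayleigh quotient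
on `Ω` is at most the one on the shell.

* The numerator: `‖∇w‖ = ‖x‖^(1-n)` is radially decreasing, so among sets outside the ball of
  radius `R₁` with prescribed volume the shell has the largest energy (`energy_le`).
* The denominator: the boundary is a radial graph `r = ρ(θ)` over the unit sphere, and radial
  projection to the sphere of radius `r` does not increase `𝓗ⁿ⁻¹` outside the ball of radius `r`.
  Cutting the boundary into thin shells gives `∫_{∂Ω₀} w² ≥ ∫ W(ρ)² ρ^(n-1) dθ`
  (`lintegral_sphere_le_lintegral`), without any differentiation of `ρ`. Now
  `W(r)² r^(n-1)` is a convex function of `t = r^n` exactly as long as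
  `(n-1) (W(r) r^(n-2))² ≤ 2`, that is, up to the critical radius (`monotoneOn_slope`). As
  `∫ ρ^n dθ` is fixed by the volume, the tangent line inequality (Jensen) bounds the integral below
  by its value for the ball (`measure_sphere_mul_le`).

For the shell itself, Cauchy–Schwarz with weight `r^(n-1)` on each ray gives
`ψ(R₂θ)² ≤ W(R₂) ∫ ‖∇ψ(rθ)‖² r^(n-1) dr` for smooth `ψ` vanishing on the inner sphere. Integrated
over the sphere this bounds every Rayleigh quotient of the shell from below (`eLpNorm_sphere_le`),
and the bound passes to the closure in `H¹` and to the traces (`eLpNorm_trace_le`).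

Polar coordinates involve `Measure.toSphere`, the traces involve `𝓗ⁿ⁻¹`. Both are finite nonzero
measures on the sphere that give equal mass to balls of equal radii, so they are proportional
(`univ_smul_eq_of_measure_ball_eq`). The factor `c` between them cancels in the comparison and is
not computed. The proof of finiteness of `𝓗ⁿ⁻¹` on the sphere uses stereographic projection.
-/

noncomputable section

namespace SteklovDirichlet

open Set Metric Module
open scoped ENNReal NNReal Pointwise

/-! ### Uniformly distributed measures -/

section UniformlyDistributed

variable {X : Type*} [MetricSpace X] [CompactSpace X] [MeasurableSpace X] [BorelSpace X]

theorem measure_ball_mul_univ (μ ν : Measure X) [IsFiniteMeasure μ] [IsFiniteMeasure ν]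
    (hμ : ∀ x y r, μ (ball x r) = μ (ball y r)) (hν : ∀ x y r, ν (ball x r) = ν (ball y r))
    (x : X) (δ : ℝ) : μ (ball x δ) * ν univ = ν (ball x δ) * μ univ := by
  have hD : MeasurableSet {p : X × X | dist p.1 p.2 < δ} :=
    (isOpen_lt (by fun_prop) (by fun_prop)).measurableSet
  have h1 := Measure.prod_apply (μ := μ) (ν := ν) hD
  have h2 := Measure.prod_apply_symm (μ := μ) (ν := ν) hD
  have e1 : ∀ y : X, Prod.mk y ⁻¹' {p : X × X | dist p.1 p.2 < δ} = ball y δ := by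
    intro y; ext z; simp [dist_comm]
  have e2 : ∀ y : X, (fun x => (x, y)) ⁻¹' {p : X × X | dist p.1 p.2 < δ} = ball y δ := by
    intro y; ext z; simp
  simp only [e1, e2, hν _ x δ, hμ _ x δ, lintegral_const] at h1 h2
  rw [← h1, ← h2]

/-- Comparing `f x` with the average of `f` over a small ball around `x` and exchanging the order
of integration bounds the `μ`-mean of `f` by its `ν`-mean. -/
theorem univ_mul_lintegral_le (μ ν : Measure X) [IsFiniteMeasure μ] [IsFiniteMeasure ν]
    (hμ : ∀ x y r, μ (ball x r) = μ (ball y r)) (hν : ∀ x y r, ν (ball x r) = ν (ball y r))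
    (hpos : ∀ x r, 0 < r → ν (ball x r) ≠ 0) {f : X → ℝ≥0} (hf : Continuous f) :
    ν univ * ∫⁻ x, f x ∂μ ≤ μ univ * ∫⁻ x, f x ∂ν := by
  rcases isEmpty_or_nonempty X with hX | ⟨⟨x₀⟩⟩
  · simp [Measure.eq_zero_of_isEmpty μ]
  have key : ∀ ε : ℝ≥0, 0 < ε →
      ν univ * ∫⁻ x, f x ∂μ ≤ μ univ * ∫⁻ x, f x ∂ν + ε * (ν univ * μ univ) := by
    intro ε hε
    obtain ⟨δ, hδ, hfδ⟩ := Metric.uniformContinuous_iff.1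
      (CompactSpace.uniformContinuous_of_continuous hf) ε hε
    have hle : ∀ x y, dist x y < δ → f x ≤ f y + ε := by
      intro x y hxy
      have := hfδ hxy
      rw [NNReal.dist_eq] at this
      have h3 : (f x : ℝ) ≤ f y + ε := by linarith [(abs_lt.1 this).2]
      exact_mod_cast h3
    set D : Set (X × X) := {p : X × X | dist p.1 p.2 < δ}
    have hD : MeasurableSet D := (isOpen_lt (by fun_prop) (by fun_prop)).measurableSet
    set K : X × X → ℝ≥0∞ := D.indicator 1
    have hK : Measurable K := measurable_one.indicator hD
    have hfm : Measurable f := hf.measurable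
    have K1 : ∀ x, ∫⁻ y, K (x, y) ∂ν = ν (ball x₀ δ) := by
      intro x
      have : (fun y => K (x, y)) = (ball x δ).indicator 1 := by
        ext y; simp [K, D, indicator, dist_comm]
      rw [this, lintegral_indicator_one measurableSet_ball, hν x x₀]
    have K2 : ∀ y, ∫⁻ x, K (x, y) ∂μ = μ (ball x₀ δ) := by
      intro y
      have : (fun x => K (x, y)) = (ball y δ).indicator 1 := by
        ext x; simp [K, D, indicator]
      rw [this, lintegral_indicator_one measurableSet_ball, hμ y x₀]
    have step : ν (ball x₀ δ) * ∫⁻ x, f x ∂μ ≤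
        μ (ball x₀ δ) * ∫⁻ x, f x ∂ν + ε * (ν (ball x₀ δ) * μ univ) := by
      calc ν (ball x₀ δ) * ∫⁻ x, f x ∂μ = ∫⁻ x, ∫⁻ y, K (x, y) * f x ∂ν ∂μ := by
            rw [← lintegral_const_mul _ (by fun_prop)]
            refine lintegral_congr fun x => ?_
            rw [lintegral_mul_const _ (by fun_prop), K1]
        _ ≤ ∫⁻ x, ∫⁻ y, (K (x, y) * f y + ε * K (x, y)) ∂ν ∂μ := by
            refine lintegral_mono fun x => lintegral_mono fun y => ?_
            by_cases hxy : (x, y) ∈ D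
            · simp only [K, indicator_of_mem hxy, Pi.one_apply, one_mul, mul_one]
              exact_mod_cast hle x y hxy
            · simp [K, indicator_of_notMem hxy]
        _ = ∫⁻ y, ∫⁻ x, (K (x, y) * f y + ε * K (x, y)) ∂μ ∂ν := by
            refine lintegral_lintegral_swap (Measurable.aemeasurable ?_)
            fun_prop
        _ = ∫⁻ y, (μ (ball x₀ δ) * f y + ε * μ (ball x₀ δ)) ∂ν := by
            refine lintegral_congr fun y => ?_
            rw [lintegral_add_left (by fun_prop), lintegral_mul_const _ (by fun_prop),
              lintegral_const_mul _ (by fun_prop), K2]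
        _ = μ (ball x₀ δ) * ∫⁻ x, f x ∂ν + ε * (ν (ball x₀ δ) * μ univ) := by
            rw [lintegral_add_left (by fun_prop), lintegral_const_mul _ (by fun_prop),
              lintegral_const, mul_assoc, measure_ball_mul_univ μ ν hμ hν]
    have h5 : ν (ball x₀ δ) * (ν univ * ∫⁻ x, f x ∂μ) ≤
        ν (ball x₀ δ) * (μ univ * ∫⁻ x, f x ∂ν + ε * (ν univ * μ univ)) := by
      calc _ = ν univ * (ν (ball x₀ δ) * ∫⁻ x, f x ∂μ) := by ring
        _ ≤ ν univ * (μ (ball x₀ δ) * ∫⁻ x, f x ∂ν + ε * (ν (ball x₀ δ) * μ univ)) := by gcongr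
        _ = (μ (ball x₀ δ) * ν univ) * ∫⁻ x, f x ∂ν
            + ν (ball x₀ δ) * (ε * (ν univ * μ univ)) := by ring
        _ = _ := by rw [measure_ball_mul_univ μ ν hμ hν]; ring
    exact (ENNReal.mul_le_mul_iff_right (hpos x₀ δ hδ) (measure_ne_top _ _)).1 h5
  have hC : ν univ * μ univ ≠ ⊤ := ENNReal.mul_ne_top (measure_ne_top _ _) (measure_ne_top _ _)
  have hlim : Tendsto (fun ε : ℝ≥0 => μ univ * ∫⁻ x, f x ∂ν + ε * (ν univ * μ univ)) (𝓝[>] 0)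
      (𝓝 (μ univ * ∫⁻ x, f x ∂ν + (0 : ℝ≥0) * (ν univ * μ univ))) := by
    refine Tendsto.const_add _ (ENNReal.Tendsto.mul_const ?_ (Or.inr hC))
    exact (ENNReal.continuous_coe.tendsto 0).mono_left nhdsWithin_le_nhds
  have := ge_of_tendsto hlim (by filter_upwards [self_mem_nhdsWithin] with ε hε using key ε hε)
  simpa using this

/-- Two finite measures for which balls of equal radii have equal measure are proportional
(Christensen's lemma). -/
theorem univ_smul_eq_of_measure_ball_eq (μ ν : Measure X) [IsFiniteMeasure μ] [IsFiniteMeasure ν]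
    (hμ : ∀ x y r, μ (ball x r) = μ (ball y r)) (hν : ∀ x y r, ν (ball x r) = ν (ball y r))
    (hpos : ∀ x r, 0 < r → ν (ball x r) ≠ 0) : ν univ • μ = μ univ • ν := by
  by_cases h0 : μ univ = 0
  · rw [Measure.measure_univ_eq_zero.1 h0]; simp
  have hpos' : ∀ x r, 0 < r → μ (ball x r) ≠ 0 := by
    intro x r hr h
    have := measure_ball_mul_univ μ ν hμ hν x r
    rw [h, zero_mul, eq_comm, mul_eq_zero] at this
    exact this.elim (hpos x r hr) h0
  have : IsFiniteMeasure (ν univ • μ) := Measure.smul_finite _ (measure_ne_top _ _)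
  have : IsFiniteMeasure (μ univ • ν) := Measure.smul_finite _ (measure_ne_top _ _)
  refine ext_of_forall_lintegral_eq_of_IsFiniteMeasure fun f => ?_
  simp only [lintegral_smul_measure, smul_eq_mul]
  exact le_antisymm (univ_mul_lintegral_le μ ν hμ hν hpos f.continuous)
    (univ_mul_lintegral_le ν μ hν hμ hpos' f.continuous)

end UniformlyDistributed

/-! ### The Hausdorff measure of the unit sphere and polar coordinates -/

section Lipschitz

variable {X Y : Type*} [EMetricSpace X] [MeasurableSpace X] [BorelSpace X]
  [EMetricSpace Y] [MeasurableSpace Y] [BorelSpace Y]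

theorem euclideanHausdorffMeasure_image_le {K : ℝ≥0} {f : X → Y} {s : Set X}
    (h : LipschitzOnWith K f s) (d : ℕ) : μHE[d] (f '' s) ≤ (K : ℝ≥0∞) ^ d * μHE[d] s := by
  have := h.hausdorffMeasure_image_le (d := d) (by positivity)
  simp only [Measure.euclideanHausdorffMeasure_def, Measure.smul_apply, ENNReal.smul_def,
    smul_eq_mul]
  rw [mul_left_comm]
  gcongr
  simpa using this

end Lipschitz

section UnitSphere

variable {E : Type*} [NormedAddCommGroup E] [InnerProductSpace ℝ E] [FiniteDimensional ℝ E]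

theorem finrank_orthogonal_unit {v : E} (hv : ‖v‖ = 1) :
    finrank ℝ (ℝ ∙ v)ᗮ = finrank ℝ E - 1 := by
  have hv0 : v ≠ 0 := by rintro rfl; simp at hv
  have h1 := Submodule.finrank_add_finrank_orthogonal (ℝ ∙ v)
  rw [finrank_span_singleton hv0] at h1
  omega

/-- The closed half sphere opposite to `v` is covered by the inverse stereographic projection of a
ball, on which that projection is Lipschitz. -/
theorem mem_image_stereoInvFunAux {E : Type*} [NormedAddCommGroup E] [InnerProductSpace ℝ E]
    {v : E} (hv : ‖v‖ = 1) {x : E} (hx : ‖x‖ = 1)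
    (hxv : inner ℝ v x ≤ 0) :
    x ∈ (fun w : (ℝ ∙ v)ᗮ => stereoInvFunAux v (w : E)) '' closedBall 0 2 := by
  have hne : x ≠ v := by
    rintro rfl
    rw [real_inner_self_eq_norm_sq, hx] at hxv
    norm_num at hxv
  refine ⟨stereoToFun v x, ?_, ?_⟩
  · rw [mem_closedBall_zero_iff, stereoToFun_apply, norm_smul]
    have h1 : ‖(ℝ ∙ v)ᗮ.orthogonalProjectionOnto x‖ ≤ 1 := by
      simpa [hx] using (ℝ ∙ v)ᗮ.norm_orthogonalProjectionOnto_apply_le x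
    have h2 : ‖(2 / (1 - inner ℝ v x) : ℝ)‖ ≤ 2 := by
      rw [Real.norm_of_nonneg (div_nonneg (by norm_num) (by linarith))]
      exact div_le_self (by norm_num) (by linarith)
    calc _ ≤ (2 : ℝ) * 1 := mul_le_mul h2 h1 (norm_nonneg _) (by norm_num)
      _ = 2 := by norm_num
  · have := stereo_left_inv hv (x := ⟨x, by simpa using hx⟩) hne
    exact congrArg Subtype.val this

variable [MeasurableSpace E] [BorelSpace E]

theorem euclideanHausdorffMeasure_sphere_lt_top :
    μHE[finrank ℝ E - 1] (sphere (0 : E) 1) < ⊤ := by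
  rcases (sphere (0 : E) 1).eq_empty_or_nonempty with h | ⟨v, hv⟩
  · simp [h]
  have hemi : ∀ v : E, ‖v‖ = 1 → μHE[finrank ℝ E - 1]
      ((fun w : (ℝ ∙ v)ᗮ => stereoInvFunAux v (w : E)) '' closedBall 0 2) < ⊤ := by
    intro v hv
    have hsm : ContDiff ℝ 1 (fun w : (ℝ ∙ v)ᗮ => stereoInvFunAux v (w : E)) :=
      contDiff_stereoInvFunAux.comp (ℝ ∙ v)ᗮ.subtypeL.contDiff
    obtain ⟨K, hK⟩ := (hsm.locallyLipschitz.locallyLipschitzOn (s := closedBall 0 2)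
      ).exists_lipschitzOnWith_of_compact (isCompact_closedBall _ _)
    refine (euclideanHausdorffMeasure_image_le hK _).trans_lt ?_
    rw [← finrank_orthogonal_unit hv, InnerProductSpace.euclideanHausdorffMeasure_eq_volume]
    exact ENNReal.mul_lt_top (by finiteness) (isCompact_closedBall _ _).measure_lt_top
  have hv1 : ‖v‖ = 1 := by simpa using hv
  have hsub : sphere (0 : E) 1 ⊆
      ((fun w : (ℝ ∙ v)ᗮ => stereoInvFunAux v (w : E)) '' closedBall 0 2) ∪
      ((fun w : (ℝ ∙ (-v))ᗮ => stereoInvFunAux (-v) (w : E)) '' closedBall 0 2) := by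
    intro x hx
    have hx1 : ‖x‖ = 1 := by simpa using hx
    rcases le_total (inner ℝ v x) 0 with h | h
    · exact Or.inl (mem_image_stereoInvFunAux hv1 hx1 h)
    · exact Or.inr (mem_image_stereoInvFunAux (by simpa using hv1) hx1
        (by simpa using h))
  exact (measure_mono hsub).trans_lt ((measure_union_le _ _).trans_lt
    (ENNReal.add_lt_top.2 ⟨hemi v hv1, hemi (-v) (by simpa using hv1)⟩))

theorem euclideanHausdorffMeasure_sphere_pos [Nontrivial E] :
    0 < μHE[finrank ℝ E - 1] (sphere (0 : E) 1) := by
  obtain ⟨v, hv⟩ := (NormedSpace.sphere_nonempty (x := (0 : E)) (r := 1)).2 zero_le_one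
  have hv1 : ‖v‖ = 1 := by simpa using hv
  have hlip : LipschitzOnWith 1 (ℝ ∙ v)ᗮ.orthogonalProjectionOnto (sphere (0 : E) 1) := by
    refine LipschitzWith.lipschitzOnWith (LipschitzWith.of_dist_le_mul fun x y => ?_)
    rw [dist_eq_norm, dist_eq_norm, ← map_sub]
    simpa using (ℝ ∙ v)ᗮ.norm_orthogonalProjectionOnto_apply_le (x - y)
  have h1 := euclideanHausdorffMeasure_image_le hlip (finrank ℝ E - 1)
  have hsub : ball (0 : (ℝ ∙ v)ᗮ) 1 ⊆ (ℝ ∙ v)ᗮ.orthogonalProjectionOnto '' sphere (0 : E) 1 := by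
    intro y hy
    have hy1 : ‖(y : E)‖ < 1 := by simpa using hy
    have hort : inner ℝ (y : E) v = 0 := by
      rw [real_inner_comm]
      exact Submodule.mem_orthogonal_singleton_iff_inner_right.1 y.2
    refine ⟨(y : E) + √(1 - ‖(y : E)‖ ^ 2) • v, ?_, ?_⟩
    · have h2 : ‖(y : E) + √(1 - ‖(y : E)‖ ^ 2) • v‖ ^ 2 = 1 := by
        rw [norm_add_sq_real, inner_smul_right, hort, norm_smul, hv1]
        have : 0 ≤ 1 - ‖(y : E)‖ ^ 2 := by nlinarith [norm_nonneg (y : E)]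
        simp [Real.sq_sqrt this]
      rw [mem_sphere_zero_iff_norm]
      nlinarith [norm_nonneg ((y : E) + √(1 - ‖(y : E)‖ ^ 2) • v)]
    · rw [map_add, map_smul]
      have : (ℝ ∙ v)ᗮ.orthogonalProjectionOnto v = 0 :=
        Submodule.orthogonalProjectionOnto_orthogonalComplement_singleton_eq_zero v
      simp [this]
  have h3 : 0 < μHE[finrank ℝ E - 1] (ball (0 : (ℝ ∙ v)ᗮ) 1) := by
    rw [← finrank_orthogonal_unit hv1, InnerProductSpace.euclideanHausdorffMeasure_eq_volume]
    exact measure_ball_pos _ _ one_pos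
  simpa using h3.trans_le ((measure_mono hsub).trans h1)

/-- Hausdorff measure and `Measure.toSphere` are invariant under isometries, which act transitively
on the sphere, so they are proportional. -/
theorem exists_map_toSphere_eq [Nontrivial E] :
    ∃ c : ℝ≥0∞, c ≠ 0 ∧ c ≠ ⊤ ∧ (μHE[finrank ℝ E - 1] : Measure E).restrict (sphere 0 1) =
      c • (volume : Measure E).toSphere.map (Subtype.val) := by
  set η : Measure (sphere (0 : E) 1) := μHE[finrank ℝ E - 1] with hη
  set τ : Measure (sphere (0 : E) 1) := (volume : Measure E).toSphere with hτ
  have hiso : Isometry (Subtype.val : sphere (0 : E) 1 → E) := isometry_subtype_coe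
  have hηu : η univ = μHE[finrank ℝ E - 1] (sphere (0 : E) 1) := by
    rw [hη, ← hiso.euclideanHausdorffMeasure_image, image_univ, Subtype.range_coe]
  have : IsFiniteMeasure η := ⟨hηu ▸ euclideanHausdorffMeasure_sphere_lt_top⟩
  -- A reflection carries any ball of the sphere onto any other one of the same radius.
  have move : ∀ (x y : sphere (0 : E) 1) (r : ℝ), ∃ L : E ≃ₗᵢ[ℝ] E,
      (Subtype.val '' ball y r : Set E) = L '' (Subtype.val '' ball x r) := by
    intro x y r
    obtain ⟨L, hL⟩ : ∃ L : E ≃ₗᵢ[ℝ] E, L x = y :=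
      ⟨(ℝ ∙ ((x : E) - y))ᗮ.reflection, Submodule.reflection_sub (by simp)⟩
    refine ⟨L, ?_⟩
    rw [Subtype.image_ball, Subtype.image_ball, ← hL]
    ext z
    simp only [LinearIsometryEquiv.image_eq_preimage_symm, mem_inter_iff, mem_ball, mem_preimage,
      Set.mem_ofPred_eq, mem_sphere_zero_iff_norm, LinearIsometryEquiv.norm_map]
    rw [← LinearIsometryEquiv.dist_map L.symm z, LinearIsometryEquiv.symm_apply_apply]
  have hηb : ∀ x y r, η (ball x r) = η (ball y r) := by
    intro x y r
    obtain ⟨L, hL⟩ := move x y r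
    rw [hη, ← hiso.euclideanHausdorffMeasure_image (ball x r),
      ← hiso.euclideanHausdorffMeasure_image (ball y r), hL,
      L.isometry.euclideanHausdorffMeasure_image]
  have hτb : ∀ x y r, τ (ball x r) = τ (ball y r) := by
    intro x y r
    obtain ⟨L, hL⟩ := move x y r
    rw [hτ, Measure.toSphere_apply' _ measurableSet_ball,
      Measure.toSphere_apply' _ measurableSet_ball, hL]
    have : Ioo (0 : ℝ) 1 • (L '' (Subtype.val '' ball x r)) =
        L '' (Ioo (0 : ℝ) 1 • (Subtype.val '' ball x r)) := by
      rw [← image2_smul, ← image2_smul, image_image2, image2_image_right]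
      simp
    rw [this, L.image_eq_preimage_symm]
    congr 1
    exact (L.symm.measurePreserving.measure_preimage_emb
      L.symm.toHomeomorph.measurableEmbedding _).symm
  have hpos : ∀ x r, 0 < r → τ (ball x r) ≠ 0 := fun x r hr => (measure_ball_pos _ _ hr).ne'
  have hτ0 : τ univ ≠ 0 := by
    rw [Measure.measure_univ_ne_zero, hτ]
    exact Measure.toSphere_ne_zero _
  have hτt : τ univ ≠ ⊤ := measure_ne_top _ _
  have hη0 : η univ ≠ 0 := hηu ▸ euclideanHausdorffMeasure_sphere_pos.ne'
  have hmain := univ_smul_eq_of_measure_ball_eq η τ hηb hτb hpos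
  refine ⟨(τ univ)⁻¹ * η univ, mul_ne_zero (ENNReal.inv_ne_zero.2 hτt) hη0,
    ENNReal.mul_ne_top (ENNReal.inv_ne_top.2 hτ0) (measure_ne_top _ _), ?_⟩
  have h2 : η = ((τ univ)⁻¹ * η univ) • τ := by
    rw [mul_smul, ← hmain, smul_smul, ENNReal.inv_mul_cancel hτ0 hτt, one_smul]
  rw [← Measure.map_smul, ← h2, hη, hiso.map_euclideanHausdorffMeasure, Subtype.range_coe]

/-- Integration in polar coordinates. -/
theorem exists_polarCoord [Nontrivial E] :
    ∃ c : ℝ≥0∞, c ≠ 0 ∧ c ≠ ⊤ ∧ ∀ f : E → ℝ≥0∞, Measurable f →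
      c * ∫⁻ x, f x = ∫⁻ θ in sphere (0 : E) 1, (∫⁻ r in Ioi (0 : ℝ),
        ENNReal.ofReal (r ^ (finrank ℝ E - 1)) * f (r • θ)) ∂μHE[finrank ℝ E - 1] := by
  obtain ⟨c, hc0, hct, hc⟩ := exists_map_toSphere_eq (E := E)
  refine ⟨c, hc0, hct, fun f hf => ?_⟩
  have hmeas : Measurable fun p : E × ℝ =>
      ENNReal.ofReal (p.2 ^ (finrank ℝ E - 1)) * f (p.2 • p.1) := by fun_prop
  rw [hc, lintegral_smul_measure, smul_eq_mul, lintegral_map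
    (Measurable.lintegral_prod_right' hmeas) measurable_subtype_coe]
  congr 1
  have hmp := (volume : Measure E).measurePreserving_homeomorphUnitSphereProd
  calc ∫⁻ x, f x = ∫⁻ x in ({0}ᶜ : Set E), f x := by rw [restrict_compl_singleton]
    _ = ∫⁻ x : ({0}ᶜ : Set E), f x ∂((volume : Measure E).comap Subtype.val) := by
        rw [lintegral_subtype_comap (measurableSet_singleton _).compl]
    _ = ∫⁻ x : ({0}ᶜ : Set E), f (((homeomorphUnitSphereProd E x).2 : ℝ) •
          ((homeomorphUnitSphereProd E x).1 : E)) ∂((volume : Measure E).comap Subtype.val) := by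
        refine lintegral_congr fun x => ?_
        have hx : ‖(x : E)‖ ≠ 0 := norm_ne_zero_iff.2 x.2
        simp [smul_smul, hx]
    _ = ∫⁻ p, f ((p.2 : ℝ) • (p.1 : E)) ∂((volume : Measure E).toSphere.prod
          (Measure.volumeIoiPow (finrank ℝ E - 1))) :=
        hmp.lintegral_comp (f := fun p => f ((p.2 : ℝ) • (p.1 : E))) (by fun_prop)
    _ = _ := by
        rw [lintegral_prod _ (by fun_prop)]
        refine lintegral_congr fun θ => ?_
        rw [Measure.volumeIoiPow, lintegral_withDensity_eq_lintegral_mul _ (by fun_prop)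
          (by fun_prop)]
        exact lintegral_subtype_comap measurableSet_Ioi
          fun r : ℝ => ENNReal.ofReal (r ^ (finrank ℝ E - 1)) * f (r • (θ : E))

theorem lintegral_sphere_eq {E : Type*} [NormedAddCommGroup E] [InnerProductSpace ℝ E]
    [MeasurableSpace E] [BorelSpace E] {R : ℝ} (hR : 0 < R) (d : ℕ) {f : E → ℝ≥0∞} (hf : Measurable f) :
    ∫⁻ x in sphere (0 : E) R, f x ∂μHE[d] =
      ENNReal.ofReal (R ^ d) * ∫⁻ θ in sphere (0 : E) 1, f (R • θ) ∂μHE[d] := by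
  have hmap : (μHE[d] : Measure E).map (fun x => R • x) = ENNReal.ofReal ((R⁻¹) ^ d) • μHE[d] := by
    ext s hs
    rw [Measure.map_apply (by fun_prop) hs, preimage_smul₀ hR.ne',
      Measure.euclideanHausdorffMeasure_smul₀ d (inv_ne_zero hR.ne'), Measure.smul_apply,
      ENNReal.smul_def, smul_eq_mul, smul_eq_mul, ENNReal.ofReal_pow (by positivity),
      ENNReal.coe_pow, ← enorm_eq_nnnorm, Real.enorm_eq_ofReal (by positivity)]
  have hpre : (fun x : E => R • x) ⁻¹' sphere 0 R = sphere 0 1 := by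
    ext x; simp [norm_smul, abs_of_pos hR, hR.ne']
  have h1 : ∫⁻ θ in sphere (0 : E) 1, f (R • θ) ∂μHE[d] =
      ENNReal.ofReal ((R⁻¹) ^ d) * ∫⁻ x in sphere (0 : E) R, f x ∂μHE[d] := by
    rw [← smul_eq_mul, ← lintegral_smul_measure, ← Measure.restrict_smul, ← hmap,
      setLIntegral_map isClosed_sphere.measurableSet hf (by fun_prop), hpre]
  rw [h1, ← mul_assoc, ← ENNReal.ofReal_mul (by positivity), ← mul_pow, mul_inv_cancel₀ hR.ne']
  simp

end UnitSphere

/-! ### Radial projection of a hypersurface -/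

section RadialProjection

variable {E : Type*} [NormedAddCommGroup E] [InnerProductSpace ℝ E]

theorem norm_inv_norm_smul_sub_le {r : ℝ} (hr : 0 < r) {x y : E} (hx : r ≤ ‖x‖) (hy : r ≤ ‖y‖) :
    ‖‖x‖⁻¹ • x - ‖y‖⁻¹ • y‖ ≤ r⁻¹ * ‖x - y‖ := by
  have hx0 : 0 < ‖x‖ := hr.trans_le hx
  have hy0 : 0 < ‖y‖ := hr.trans_le hy
  refine (pow_le_pow_iff_left₀ (norm_nonneg _) (by positivity) two_ne_zero).1 ?_
  have h1 : ‖‖x‖⁻¹ • x - ‖y‖⁻¹ • y‖ ^ 2 = 2 - 2 * (inner ℝ x y / (‖x‖ * ‖y‖)) := by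
    rw [norm_sub_sq_real, norm_smul, norm_smul, inner_smul_left, inner_smul_right]
    simp only [norm_inv, norm_norm, RCLike.conj_to_real]
    field_simp
    ring
  have h2 : ‖x - y‖ ^ 2 = ‖x‖ ^ 2 - 2 * inner ℝ x y + ‖y‖ ^ 2 := norm_sub_sq_real x y
  set t := inner ℝ x y / (‖x‖ * ‖y‖) with ht
  have h3 : inner ℝ x y = t * (‖x‖ * ‖y‖) := by rw [ht]; field_simp
  have ht1 : t ≤ 1 := by
    rw [ht, div_le_one (by positivity)]
    exact real_inner_le_norm x y
  rw [h1, mul_pow, inv_pow, h2, h3, ← div_eq_inv_mul, le_div_iff₀ (by positivity)]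
  have h4 : r ^ 2 ≤ ‖x‖ * ‖y‖ := by rw [pow_two]; exact mul_le_mul hx hy hr.le hx0.le
  nlinarith [sq_nonneg (‖x‖ - ‖y‖), mul_nonneg (sub_nonneg.2 ht1) (sub_nonneg.2 h4)]

variable [MeasurableSpace E] [BorelSpace E]

/-- A set `Γ` meeting every ray has at least the measure of the sphere after weighting by
`‖x‖⁻ᵈ`: on a thin shell the radial projection contracts by nearly that factor. -/
theorem measure_inter_sphere_le (d : ℕ) {Γ : Set E} (hΓ : MeasurableSet Γ) (h0 : (0 : E) ∉ Γ)
    (hsurj : ∀ θ ∈ sphere (0 : E) 1, ∃ t : ℝ, 0 < t ∧ t • θ ∈ Γ) {B : Set E}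
    (hB : MeasurableSet B) :
    μHE[d] (B ∩ sphere 0 1) ≤
      ∫⁻ x in Γ ∩ (fun x => ‖x‖⁻¹ • x) ⁻¹' B, ENNReal.ofReal (‖x‖⁻¹ ^ d) ∂μHE[d] := by
  set p : E → E := fun x => ‖x‖⁻¹ • x with hp
  have hpm : Measurable p := by fun_prop
  set I := ∫⁻ x in Γ ∩ p ⁻¹' B, ENNReal.ofReal (‖x‖⁻¹ ^ d) ∂μHE[d] with hI
  -- Cut `Γ` into the shells `q ^ i ≤ ‖x‖ < q ^ (i + 1)`, on which `p` is `q ^ (-i)`-Lipschitz.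
  have key : ∀ q : ℝ, 1 < q → μHE[d] (B ∩ sphere 0 1) ≤ ENNReal.ofReal (q ^ d) * I := by
    intro q hq
    have hq0 : 0 < q := one_pos.trans hq
    set A : ℤ → Set E := fun i => (Γ ∩ p ⁻¹' B) ∩ {x | ‖x‖ ∈ Ico (q ^ i) (q ^ (i + 1))} with hA
    have hAm : ∀ i, MeasurableSet (A i) := fun i =>
      (hΓ.inter (hpm hB)).inter (measurable_norm measurableSet_Ico)
    have hAd : Pairwise (Function.onFun Disjoint A) := by
      intro i j hij
      refine Disjoint.mono inter_subset_right inter_subset_right ?_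
      rw [Set.disjoint_left]
      intro x hx hx'
      exact Set.disjoint_left.1
        ((zpow_right_mono₀ hq.le).pairwise_disjoint_on_Ico_succ hij) hx hx'
    have hAU : ⋃ i, A i = Γ ∩ p ⁻¹' B := by
      rw [hA, ← inter_iUnion]
      refine inter_eq_left.2 fun x hx => mem_iUnion.2 ?_
      have : x ≠ 0 := fun h => h0 (h ▸ hx.1)
      exact exists_mem_Ico_zpow (norm_pos_iff.2 this) hq
    have hsub : B ∩ sphere 0 1 ⊆ ⋃ i, p '' A i := by
      rintro θ ⟨hθB, hθ⟩
      obtain ⟨t, ht, htΓ⟩ := hsurj θ hθ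
      have hθ1 : ‖θ‖ = 1 := by simpa using hθ
      have hpt : p (t • θ) = θ := by
        simp [hp, norm_smul, hθ1, abs_of_pos ht, smul_smul, ht.ne']
      have : t • θ ∈ ⋃ i, A i := by
        rw [hAU]; exact ⟨htΓ, by rwa [mem_preimage, hpt]⟩
      obtain ⟨i, hi⟩ := mem_iUnion.1 this
      exact mem_iUnion.2 ⟨i, t • θ, hi, hpt⟩
    have hi : ∀ i, μHE[d] (p '' A i) ≤
        ENNReal.ofReal (q ^ d) * ∫⁻ x in A i, ENNReal.ofReal (‖x‖⁻¹ ^ d) ∂μHE[d] := by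
      intro i
      have hqi : (0 : ℝ) < q ^ i := zpow_pos hq0 i
      have hlip : LipschitzOnWith (Real.toNNReal (q ^ i)⁻¹) p (A i) := by
        refine LipschitzOnWith.of_dist_le_mul fun x hx y hy => ?_
        rw [dist_eq_norm, dist_eq_norm, Real.coe_toNNReal _ (by positivity)]
        exact norm_inv_norm_smul_sub_le hqi hx.2.1 hy.2.1
      refine (euclideanHausdorffMeasure_image_le hlip d).trans ?_
      rw [← lintegral_const_mul _ (by fun_prop), ← setLIntegral_const]
      refine setLIntegral_mono (by fun_prop) fun x hx => ?_
      rw [← ENNReal.ofReal_mul (by positivity), ← mul_pow]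
      change ENNReal.ofReal _ ^ d ≤ _
      rw [← ENNReal.ofReal_pow (by positivity)]
      refine ENNReal.ofReal_le_ofReal (pow_le_pow_left₀ (by positivity) ?_ d)
      have hx0 : 0 < ‖x‖ := hqi.trans_le hx.2.1
      have := hx.2.2.le
      rw [zpow_add_one₀ hq0.ne'] at this
      rw [← div_eq_mul_inv, inv_eq_one_div, div_le_div_iff₀ hqi hx0]
      linarith
    calc μHE[d] (B ∩ sphere 0 1) ≤ μHE[d] (⋃ i, p '' A i) := measure_mono hsub
      _ ≤ ∑' i, μHE[d] (p '' A i) := measure_iUnion_le _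
      _ ≤ ∑' i, ENNReal.ofReal (q ^ d) * ∫⁻ x in A i, ENNReal.ofReal (‖x‖⁻¹ ^ d) ∂μHE[d] :=
          ENNReal.tsum_le_tsum hi
      _ = ENNReal.ofReal (q ^ d) * I := by
          rw [ENNReal.tsum_mul_left, ← lintegral_iUnion hAm hAd, hAU]
  have hlim : Tendsto (fun q : ℝ => ENNReal.ofReal (q ^ d) * I) (𝓝[>] 1)
      (𝓝 (ENNReal.ofReal (1 ^ d) * I)) := by
    refine ENNReal.Tendsto.mul_const ?_ (Or.inl (by simp))
    exact ((ENNReal.continuous_ofReal.comp (continuous_pow d)).tendsto (1 : ℝ)).mono_left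
      nhdsWithin_le_nhds
  have := ge_of_tendsto hlim (by filter_upwards [self_mem_nhdsWithin] with q hq using key q hq)
  simpa using this

/-- Radial projection to the unit sphere does not increase `‖x‖ ^ (-d)` times the `d`-dimensional
measure. -/
theorem lintegral_sphere_le_lintegral (d : ℕ) {Γ : Set E} (hΓ : MeasurableSet Γ)
    (h0 : (0 : E) ∉ Γ) (hsurj : ∀ θ ∈ sphere (0 : E) 1, ∃ t : ℝ, 0 < t ∧ t • θ ∈ Γ)
    {Φ : E → ℝ≥0∞} (hΦ : Measurable Φ) :
    ∫⁻ θ in sphere (0 : E) 1, Φ θ ∂μHE[d] ≤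
      ∫⁻ x in Γ, ENNReal.ofReal (‖x‖⁻¹ ^ d) * Φ (‖x‖⁻¹ • x) ∂μHE[d] := by
  have hpm : Measurable (fun x : E => ‖x‖⁻¹ • x) := by fun_prop
  have hle : (μHE[d] : Measure E).restrict (sphere 0 1) ≤
      ((μHE[d].restrict Γ).withDensity fun x => ENNReal.ofReal (‖x‖⁻¹ ^ d)).map
        (fun x => ‖x‖⁻¹ • x) := by
    refine Measure.le_iff.2 fun B hB => ?_
    rw [Measure.restrict_apply hB, Measure.map_apply hpm hB, withDensity_apply _ (hpm hB),
      Measure.restrict_restrict (hpm hB), inter_comm _ Γ]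
    exact measure_inter_sphere_le d hΓ h0 hsurj hB
  refine (lintegral_mono' hle le_rfl).trans_eq ?_
  rw [lintegral_map hΦ hpm, lintegral_withDensity_eq_lintegral_mul _ (by fun_prop) (by fun_prop)]
  rfl

end RadialProjection

/-! ### Bounded open convex sets as radial graphs -/

section ConvexBody

theorem ne_zero_of_mem_sphere {E : Type*} [NormedAddCommGroup E] {θ : E}
    (hθ : θ ∈ sphere (0 : E) 1) : θ ≠ 0 := by
  rintro rfl; simp at hθ

variable {E : Type*} [NormedAddCommGroup E] [InnerProductSpace ℝ E] {Ω₀ : Set E}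

/-- An open bounded convex set around the origin. -/
structure IsConvexDomain (Ω₀ : Set E) : Prop where
  isOpen : IsOpen Ω₀
  isBounded : Bornology.IsBounded Ω₀
  convex : Convex ℝ Ω₀
  zero_mem : (0 : E) ∈ Ω₀

/-- The distance from the origin to the boundary point of `Ω₀` in the direction of the unit
vector `θ`. -/
def radius (Ω₀ : Set E) (θ : E) : ℝ := (gauge Ω₀ θ)⁻¹

namespace IsConvexDomain

theorem mem_nhds (h : IsConvexDomain Ω₀) : Ω₀ ∈ 𝓝 (0 : E) := h.isOpen.mem_nhds h.zero_mem

theorem gauge_pos (h : IsConvexDomain Ω₀) {x : E} (hx : x ≠ 0) : 0 < gauge Ω₀ x :=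
  (_root_.gauge_pos (absorbent_nhds_zero h.mem_nhds)
    ((NormedSpace.isVonNBounded_iff ℝ).2 h.isBounded)).2 hx

theorem mem_iff (h : IsConvexDomain Ω₀) {x : E} : x ∈ Ω₀ ↔ gauge Ω₀ x < 1 := by
  rw [gauge_lt_one_iff_mem_interior h.convex h.mem_nhds, h.isOpen.interior_eq]

theorem mem_frontier_iff (h : IsConvexDomain Ω₀) {x : E} : x ∈ frontier Ω₀ ↔ gauge Ω₀ x = 1 :=
  (gauge_eq_one_iff_mem_frontier h.convex h.mem_nhds).symm

theorem continuous_gauge (h : IsConvexDomain Ω₀) : Continuous (gauge Ω₀) :=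
  _root_.continuous_gauge h.convex h.mem_nhds

theorem zero_notMem_frontier (h : IsConvexDomain Ω₀) : (0 : E) ∉ frontier Ω₀ := by
  simp [h.mem_frontier_iff]

theorem radius_pos (h : IsConvexDomain Ω₀) {θ : E} (hθ : θ ≠ 0) : 0 < radius Ω₀ θ :=
  inv_pos.2 (h.gauge_pos hθ)

theorem smul_mem_iff (h : IsConvexDomain Ω₀) {θ : E} (hθ : θ ≠ 0) {r : ℝ} (hr : 0 ≤ r) :
    r • θ ∈ Ω₀ ↔ r < radius Ω₀ θ := by
  rw [h.mem_iff, gauge_smul_of_nonneg hr, smul_eq_mul, radius,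
    ← lt_div_iff₀ (h.gauge_pos hθ), one_div]

theorem smul_mem_frontier_iff (h : IsConvexDomain Ω₀) {θ : E} (hθ : θ ≠ 0) {r : ℝ} (hr : 0 ≤ r) :
    r • θ ∈ frontier Ω₀ ↔ r = radius Ω₀ θ := by
  rw [h.mem_frontier_iff, gauge_smul_of_nonneg hr, smul_eq_mul, radius,
    ← eq_div_iff (h.gauge_pos hθ).ne', one_div]

theorem exists_smul_mem_frontier (h : IsConvexDomain Ω₀) {θ : E} (hθ : θ ∈ sphere (0 : E) 1) :
    ∃ t : ℝ, 0 < t ∧ t • θ ∈ frontier Ω₀ :=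
  have hθ0 := ne_zero_of_mem_sphere hθ
  ⟨radius Ω₀ θ, h.radius_pos hθ0, (h.smul_mem_frontier_iff hθ0 (h.radius_pos hθ0).le).2 rfl⟩

theorem radius_of_mem_frontier (h : IsConvexDomain Ω₀) {x : E} (hx : x ∈ frontier Ω₀) :
    radius Ω₀ (‖x‖⁻¹ • x) = ‖x‖ := by
  rw [radius, gauge_smul_of_nonneg (by positivity), h.mem_frontier_iff.1 hx]
  simp

theorem continuousOn_radius (h : IsConvexDomain Ω₀) :
    ContinuousOn (radius Ω₀) (sphere 0 1) :=
  h.continuous_gauge.continuousOn.inv₀ fun _ hθ => (h.gauge_pos (ne_zero_of_mem_sphere hθ)).ne'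

variable [MeasurableSpace E] [BorelSpace E]

theorem measurable_radius (h : IsConvexDomain Ω₀) : Measurable (radius Ω₀) :=
  h.continuous_gauge.measurable.inv

/-- The surface integral of a radial function over `∂Ω₀` is at least its integral in polar
coordinates without the area factor of the graph. -/
theorem lintegral_sphere_radius_le (h : IsConvexDomain Ω₀) {F : ℝ → ℝ≥0∞} (hF : Measurable F) :
    ∫⁻ θ in sphere (0 : E) 1, ENNReal.ofReal (radius Ω₀ θ ^ (finrank ℝ E - 1)) * F (radius Ω₀ θ)
        ∂μHE[finrank ℝ E - 1] ≤
      ∫⁻ x in frontier Ω₀, F ‖x‖ ∂μHE[finrank ℝ E - 1] := by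
  have hm := h.measurable_radius
  refine (lintegral_sphere_le_lintegral (finrank ℝ E - 1) isClosed_frontier.measurableSet
    h.zero_notMem_frontier (fun θ hθ => h.exists_smul_mem_frontier hθ)
    (Φ := fun θ => ENNReal.ofReal (radius Ω₀ θ ^ (finrank ℝ E - 1)) * F (radius Ω₀ θ))
    (by fun_prop)).trans_eq ?_
  refine setLIntegral_congr_fun isClosed_frontier.measurableSet fun x hx => ?_
  have hx0 : x ≠ 0 := fun h0 => h.zero_notMem_frontier (h0 ▸ hx)
  have hxn : ‖x‖ ≠ 0 := norm_ne_zero_iff.2 hx0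
  simp only [h.radius_of_mem_frontier hx]
  rw [← mul_assoc, ← ENNReal.ofReal_mul (by positivity), ← mul_pow, inv_mul_cancel₀ hxn]
  simp

variable [FiniteDimensional ℝ E]

/-- The boundary is the image of the unit sphere under the Lipschitz map `x ↦ x / gauge x`. -/
theorem measure_frontier_lt_top (h : IsConvexDomain Ω₀) :
    μHE[finrank ℝ E - 1] (frontier Ω₀) < ⊤ := by
  obtain ⟨K, hK⟩ := h.convex.lipschitz_gauge h.mem_nhds
  obtain ⟨R, hR, hΩR⟩ := h.isBounded.subset_closedBall_lt 0 0
  have hm : ∀ x ∈ sphere (0 : E) 1, R⁻¹ ≤ gauge Ω₀ x := by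
    intro x hx
    have := le_gauge_of_subset_closedBall (absorbent_nhds_zero h.mem_nhds) hR.le hΩR (x := x)
    simpa [mem_sphere_zero_iff_norm.1 hx] using this
  have hlip : LipschitzOnWith (Real.toNNReal (R + R * R * K))
      (fun x => (gauge Ω₀ x)⁻¹ • x) (sphere 0 1) := by
    refine LipschitzOnWith.of_dist_le_mul fun x hx y hy => ?_
    rw [Real.coe_toNNReal _ (by positivity), dist_eq_norm, dist_eq_norm]
    have hx1 := hm x hx
    have hy1 := hm y hy
    have hR' : 0 < R⁻¹ := inv_pos.2 hR
    have hgx : 0 < gauge Ω₀ x := hR'.trans_le hx1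
    have hgy : 0 < gauge Ω₀ y := hR'.trans_le hy1
    have hix : (gauge Ω₀ x)⁻¹ ≤ R := inv_le_of_inv_le₀ hR hx1
    have hiy : (gauge Ω₀ y)⁻¹ ≤ R := inv_le_of_inv_le₀ hR hy1
    have hyn : ‖y‖ = 1 := by simpa using hy
    have hsplit : (gauge Ω₀ x)⁻¹ • x - (gauge Ω₀ y)⁻¹ • y =
        (gauge Ω₀ x)⁻¹ • (x - y) + ((gauge Ω₀ x)⁻¹ - (gauge Ω₀ y)⁻¹) • y := by
      rw [smul_sub, sub_smul]; abel
    have hdiff : |(gauge Ω₀ x)⁻¹ - (gauge Ω₀ y)⁻¹| ≤ R * R * (K * ‖x - y‖) := by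
      rw [inv_sub_inv hgx.ne' hgy.ne', div_eq_mul_inv, mul_inv, abs_mul, abs_mul,
        abs_of_pos (inv_pos.2 hgx), abs_of_pos (inv_pos.2 hgy), mul_comm]
      have := hK.dist_le_mul y x
      rw [Real.dist_eq, dist_comm, dist_eq_norm] at this
      gcongr
    calc ‖(gauge Ω₀ x)⁻¹ • x - (gauge Ω₀ y)⁻¹ • y‖
        ≤ ‖(gauge Ω₀ x)⁻¹ • (x - y)‖ + ‖((gauge Ω₀ x)⁻¹ - (gauge Ω₀ y)⁻¹) • y‖ := by
          rw [hsplit]; exact norm_add_le _ _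
      _ = (gauge Ω₀ x)⁻¹ * ‖x - y‖ + |(gauge Ω₀ x)⁻¹ - (gauge Ω₀ y)⁻¹| := by
          rw [norm_smul, norm_smul, hyn, mul_one, Real.norm_eq_abs, Real.norm_eq_abs,
            abs_of_pos (inv_pos.2 hgx)]
      _ ≤ R * ‖x - y‖ + R * R * (K * ‖x - y‖) := by gcongr
      _ = (R + R * R * K) * ‖x - y‖ := by ring
  have hsub : frontier Ω₀ ⊆ (fun x => (gauge Ω₀ x)⁻¹ • x) '' sphere 0 1 := by
    intro x hx
    have hx0 : x ≠ 0 := fun h0 => h.zero_notMem_frontier (h0 ▸ hx)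
    refine ⟨‖x‖⁻¹ • x, by simp [norm_smul, hx0], ?_⟩
    have := h.radius_of_mem_frontier hx
    rw [radius] at this
    simp [this, smul_smul, hx0]
  refine (measure_mono hsub).trans_lt
    ((euclideanHausdorffMeasure_image_le hlip _).trans_lt (ENNReal.mul_lt_top (by finiteness) ?_))
  exact euclideanHausdorffMeasure_sphere_lt_top

theorem measure_frontier_pos [Nontrivial E] (h : IsConvexDomain Ω₀) :
    0 < μHE[finrank ℝ E - 1] (frontier Ω₀) := by
  rw [pos_iff_ne_zero]
  intro h0
  have := lintegral_sphere_le_lintegral (finrank ℝ E - 1) isClosed_frontier.measurableSet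
    h.zero_notMem_frontier (fun θ hθ => h.exists_smul_mem_frontier hθ) (Φ := 1) measurable_one
  rw [Measure.restrict_eq_zero.2 h0, lintegral_zero_measure] at this
  simp only [Pi.one_apply, lintegral_const, one_mul, Measure.restrict_apply_univ] at this
  exact euclideanHausdorffMeasure_sphere_pos.not_ge this

end IsConvexDomain

theorem isConvexDomain_ball {R : ℝ} (hR : 0 < R) : IsConvexDomain (ball (0 : E) R) :=
  ⟨isOpen_ball, isBounded_ball, convex_ball _ _, mem_ball_self hR⟩

theorem radius_ball {R : ℝ} (hR : 0 < R) {θ : E} (hθ : ‖θ‖ = 1) :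
    radius (ball (0 : E) R) θ = R := by
  rw [radius, gauge_ball hR.le, hθ, one_div, inv_inv]

end ConvexBody

/-! ### Volumes in polar coordinates -/

section Polar

variable {E : Type*} [NormedAddCommGroup E] [InnerProductSpace ℝ E] [FiniteDimensional ℝ E]
  [MeasurableSpace E] [BorelSpace E]

variable (E) in
/-- `c` is the ratio of the Hausdorff measure of the unit sphere of `E` to the surface measure
which appears in polar coordinates. (With the Euclidean normalization it is `1`, but only its
being positive and finite matters here.) -/
structure IsPolarConstant (c : ℝ≥0∞) : Prop where
  ne_zero : c ≠ 0
  ne_top : c ≠ ⊤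
  lintegral_eq : ∀ f : E → ℝ≥0∞, Measurable f →
    c * ∫⁻ x, f x = ∫⁻ θ in sphere (0 : E) 1, (∫⁻ r in Ioi (0 : ℝ),
      ENNReal.ofReal (r ^ (finrank ℝ E - 1)) * f (r • θ)) ∂μHE[finrank ℝ E - 1]

theorem lintegral_Ioo_ofReal {f : ℝ → ℝ} {a b : ℝ} (hab : a ≤ b) (hf : ContinuousOn f (Icc a b))
    (hf0 : ∀ x ∈ Icc a b, 0 ≤ f x) :
    ∫⁻ r in Ioo a b, ENNReal.ofReal (f r) = ENNReal.ofReal (∫ r in a..b, f r) := by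
  rw [intervalIntegral.integral_of_le hab, integral_Ioc_eq_integral_Ioo]
  refine (ofReal_integral_eq_lintegral_ofReal
    (hf.integrableOn_Icc.mono_set Ioo_subset_Icc_self) ?_).symm
  filter_upwards [ae_restrict_mem measurableSet_Ioo] with x hx using hf0 x (Ioo_subset_Icc_self hx)

theorem IsConvexDomain.polar_volume [Nontrivial E] {c : ℝ≥0∞} (hc : IsPolarConstant E c)
    {Ω₀ : Set E} (h : IsConvexDomain Ω₀) :
    c * volume Ω₀ = ∫⁻ θ in sphere (0 : E) 1,
      ENNReal.ofReal (radius Ω₀ θ ^ finrank ℝ E / finrank ℝ E) ∂μHE[finrank ℝ E - 1] := by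
  have hn : 0 < finrank ℝ E := finrank_pos
  rw [← lintegral_indicator_one h.isOpen.measurableSet,
    hc.lintegral_eq _ (measurable_one.indicator h.isOpen.measurableSet)]
  refine setLIntegral_congr_fun isClosed_sphere.measurableSet fun θ hθ => ?_
  have hθ0 := ne_zero_of_mem_sphere hθ
  have h1 : ∀ r ∈ Ioi (0 : ℝ), ENNReal.ofReal (r ^ (finrank ℝ E - 1)) *
      Ω₀.indicator 1 (r • θ) = (Ioo 0 (radius Ω₀ θ)).indicator
        (fun r => ENNReal.ofReal (r ^ (finrank ℝ E - 1))) r := by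
    intro r hr
    have := h.smul_mem_iff hθ0 (le_of_lt hr)
    by_cases hr' : r < radius Ω₀ θ
    · rw [indicator_of_mem (this.2 hr'), indicator_of_mem (show r ∈ Ioo 0 _ from ⟨hr, hr'⟩)]
      simp
    · rw [indicator_of_notMem (fun h => hr' (this.1 h)), indicator_of_notMem (fun h => hr' h.2)]
      simp
  rw [setLIntegral_congr_fun measurableSet_Ioi h1, lintegral_indicator measurableSet_Ioo,
    Measure.restrict_restrict measurableSet_Ioo, inter_eq_left.2 Ioo_subset_Ioi_self,
    lintegral_Ioo_ofReal (h.radius_pos hθ0).le (by fun_prop)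
      (fun x hx => pow_nonneg hx.1 _), integral_pow]
  rw [Nat.sub_add_cancel hn]
  simp [hn.ne', Nat.cast_sub hn]

end Polar

/-! ### The radial harmonic function -/

section Potential

/-- The radial profile of the harmonic function of `ℝ^(d+1) \ {0}` that vanishes on the sphere of
radius `R₁`: its derivative is `r ^ (-d)`. Only the values at `r > 0` are meaningful. -/
def potential (d : ℕ) (R₁ r : ℝ) : ℝ := ∫ s in R₁..r, (s ^ d)⁻¹

variable {d : ℕ} {R₁ : ℝ}

theorem continuousOn_inv_pow (d : ℕ) : ContinuousOn (fun s : ℝ => (s ^ d)⁻¹) (Ioi 0) :=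
  (continuous_pow d).continuousOn.inv₀ fun _ hs => pow_ne_zero _ (ne_of_gt hs)

theorem intervalIntegrable_inv_pow (d : ℕ) {a b : ℝ} (ha : 0 < a) (hb : 0 < b) :
    IntervalIntegrable (fun s : ℝ => (s ^ d)⁻¹) volume a b :=
  ((continuousOn_inv_pow d).mono fun _ hx => (lt_min ha hb).trans_le hx.1).intervalIntegrable

theorem hasDerivAt_potential (hR : 0 < R₁) {r : ℝ} (hr : 0 < r) :
    HasDerivAt (potential d R₁) (r ^ d)⁻¹ r :=
  intervalIntegral.integral_hasDerivAt_right (intervalIntegrable_inv_pow d hR hr)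
    ((continuousOn_inv_pow d).stronglyMeasurableAtFilter isOpen_Ioi r hr)
    ((continuousOn_inv_pow d).continuousAt (Ioi_mem_nhds hr))

theorem continuousOn_potential (hR : 0 < R₁) : ContinuousOn (potential d R₁) (Ioi 0) :=
  fun _ hr => (hasDerivAt_potential hR hr).continuousAt.continuousWithinAt

theorem potential_self : potential d R₁ R₁ = 0 := by simp [potential]

theorem strictMonoOn_potential (hR : 0 < R₁) : StrictMonoOn (potential d R₁) (Ioi 0) := by
  refine strictMonoOn_of_deriv_pos (convex_Ioi 0) (continuousOn_potential hR) fun r hr => ?_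
  rw [interior_Ioi] at hr
  rw [(hasDerivAt_potential hR hr).deriv]
  exact inv_pos.2 (pow_pos hr d)

theorem potential_pos (hR : 0 < R₁) {r : ℝ} (hr : R₁ < r) : 0 < potential d R₁ r := by
  rw [← potential_self (d := d) (R₁ := R₁)]
  exact strictMonoOn_potential hR hR (hR.trans hr) hr

theorem potential_nonneg (hR : 0 < R₁) {r : ℝ} (hr : R₁ ≤ r) : 0 ≤ potential d R₁ r := by
  rw [← potential_self (d := d) (R₁ := R₁)]
  exact (strictMonoOn_potential hR).monotoneOn hR (hR.trans_le hr) hr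

theorem potential_nonpos {r : ℝ} (hr0 : 0 ≤ r) (hr : r ≤ R₁) : potential d R₁ r ≤ 0 := by
  rw [potential, intervalIntegral.integral_symm, neg_nonpos]
  exact intervalIntegral.integral_nonneg hr fun s hs =>
    inv_nonneg.2 (pow_nonneg (hr0.trans hs.1) d)

theorem contDiffOn_potential (hR : 0 < R₁) : ContDiffOn ℝ ∞ (potential d R₁) (Ioi 0) := by
  rw [contDiffOn_infty_iff_deriv_of_isOpen isOpen_Ioi]
  refine ⟨fun r hr => (hasDerivAt_potential hR hr).differentiableAt.differentiableWithinAt, ?_⟩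
  have : ContDiffOn ℝ ∞ (fun s : ℝ => (s ^ d)⁻¹) (Ioi 0) :=
    (contDiff_id.pow d).contDiffOn.inv fun s hs => pow_ne_zero _ (ne_of_gt hs)
  exact this.congr fun r hr => (hasDerivAt_potential hR hr).deriv

/-- The bound that defines the critical radius. -/
theorem potential_mul_pow_sq_le (m : ℕ) (hR : 0 < R₁) {r : ℝ} (hr : R₁ ≤ r)
    (hrc : r ≤ criticalRadius (m + 2) R₁) :
    (m + 1) * (potential (m + 1) R₁ r * r ^ m) ^ 2 ≤ 2 := by
  have hr0 : 0 < r := hR.trans_le hr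
  rcases Nat.eq_zero_or_pos m with rfl | hm
  · have hlog : potential 1 R₁ r = Real.log (r / R₁) := by
      simp only [potential, pow_one]
      exact integral_inv_of_pos hR hr0
    have h0 : 0 ≤ Real.log (r / R₁) := Real.log_nonneg ((one_le_div hR).2 hr)
    have h1 : Real.log (r / R₁) ≤ √2 := by
      rw [Real.log_le_iff_le_exp (by positivity), div_le_iff₀ hR, mul_comm]
      simpa [criticalRadius] using hrc
    simp only [zero_add, pow_zero, mul_one, hlog, Nat.cast_zero, one_mul]
    calc Real.log (r / R₁) ^ 2 ≤ √2 ^ 2 := pow_le_pow_left₀ h0 h1 2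
      _ = 2 := Real.sq_sqrt (by norm_num)
  · have hm0 : (0 : ℝ) < m := by exact_mod_cast hm
    have hW : potential (m + 1) R₁ r * r ^ m = ((r / R₁) ^ m - 1) / m := by
      have hint : potential (m + 1) R₁ r = -(r ^ m)⁻¹ / m - -(R₁ ^ m)⁻¹ / m := by
        refine intervalIntegral.integral_eq_sub_of_hasDerivAt (f := fun s => -(s ^ m)⁻¹ / m)
          (fun s hs => ?_) (intervalIntegrable_inv_pow _ hR hr0)
        have hs0 : 0 < s := (lt_min hR hr0).trans_le hs.1
        have := (((hasDerivAt_pow m s).inv (pow_ne_zero m hs0.ne')).neg).div_const (m : ℝ)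
        refine this.congr_deriv ?_
        obtain ⟨k, rfl⟩ : ∃ k, m = k + 1 := ⟨m - 1, by omega⟩
        rw [Nat.add_sub_cancel]
        field_simp
        ring
      rw [hint, div_pow]
      field_simp
      ring
    set K : ℝ := ((m + 1 : ℝ) + m * √(2 * (m + 1))) / (m + 1) with hK
    have hK0 : 0 ≤ K := by positivity
    have hcr : criticalRadius (m + 2) R₁ = R₁ * K ^ (1 / (m : ℝ)) := by
      rw [criticalRadius, if_neg (by omega), hK]
      push_cast
      ring_nf
    have h1 : (r / R₁) ^ m ≤ K := by
      have : r / R₁ ≤ K ^ (1 / (m : ℝ)) := by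
        rw [div_le_iff₀ hR, mul_comm, ← hcr]; exact hrc
      calc (r / R₁) ^ m ≤ (K ^ (1 / (m : ℝ))) ^ m := pow_le_pow_left₀ (by positivity) this m
        _ = K := by
          rw [← Real.rpow_natCast, ← Real.rpow_mul hK0, one_div_mul_cancel hm0.ne', Real.rpow_one]
    have h2 : 1 ≤ (r / R₁) ^ m := one_le_pow₀ ((one_le_div hR).2 hr)
    have h3 : potential (m + 1) R₁ r * r ^ m ≤ √(2 * (m + 1)) / (m + 1) := by
      rw [hW, div_le_iff₀ hm0]
      have : K = 1 + √(2 * (m + 1)) / (m + 1) * m := by rw [hK]; field_simp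
      linarith
    have h4 : 0 ≤ potential (m + 1) R₁ r * r ^ m :=
      mul_nonneg (potential_nonneg hR hr) (by positivity)
    calc ((m : ℝ) + 1) * (potential (m + 1) R₁ r * r ^ m) ^ 2
        ≤ (m + 1) * (√(2 * (m + 1)) / (m + 1)) ^ 2 := by gcongr
      _ = 2 := by
        rw [div_pow, Real.sq_sqrt (by positivity)]
        field_simp

/-- Below the critical radius `W² rᵈ` is a convex function of `r ^ (d + 1)`: its derivative is
nondecreasing. -/
theorem monotoneOn_slope (m : ℕ) (hR : 0 < R₁) :
    MonotoneOn (fun r => 2 * potential (m + 1) R₁ r * (r ^ (m + 1))⁻¹ +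
      (m + 1) * potential (m + 1) R₁ r ^ 2 * r⁻¹) (Icc R₁ (criticalRadius (m + 2) R₁)) := by
  set W := potential (m + 1) R₁ with hW
  have hder : ∀ r, 0 < r → HasDerivAt (fun r => 2 * W r * (r ^ (m + 1))⁻¹ + (m + 1) * W r ^ 2 * r⁻¹)
      (((r ^ (m + 1))⁻¹) ^ 2 * (2 - (m + 1) * (W r * r ^ m) ^ 2)) r := by
    intro r hr
    have hWr : HasDerivAt W (r ^ (m + 1))⁻¹ r := hasDerivAt_potential hR hr
    have h1 := (hWr.const_mul 2).mul ((hasDerivAt_pow (m + 1) r).inv (pow_ne_zero _ hr.ne'))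
    have h2 := ((hWr.pow 2).const_mul ((m : ℝ) + 1)).mul (hasDerivAt_inv hr.ne')
    refine (h1.add h2).congr_deriv ?_
    simp only [Nat.add_sub_cancel, Pi.inv_apply, Pi.pow_apply, pow_succ r m]
    push_cast
    field_simp
    ring
  refine monotoneOn_of_deriv_nonneg (convex_Icc _ _) (fun r hr =>
    (hder r (hR.trans_le hr.1)).continuousAt.continuousWithinAt) ?_ ?_
  · intro r hr
    rw [interior_Icc] at hr
    exact (hder r (hR.trans hr.1)).differentiableAt.differentiableWithinAt
  · intro r hr
    rw [interior_Icc] at hr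
    rw [(hder r (hR.trans hr.1)).deriv]
    have := potential_mul_pow_sq_le m hR hr.1.le hr.2.le
    exact mul_nonneg (by positivity) (by linarith)

/-- The tangent line inequality for `W² rᵈ` as a convex function of `r ^ (d + 1)`, at `b`. -/
theorem exists_tangent_le (m : ℕ) (hR : 0 < R₁) {b : ℝ}
    (hb : b ∈ Icc R₁ (criticalRadius (m + 2) R₁)) :
    ∃ κ : ℝ, ∀ r ∈ Icc R₁ (criticalRadius (m + 2) R₁),
      potential (m + 1) R₁ b ^ 2 * b ^ (m + 1) + κ * (r ^ (m + 2) - b ^ (m + 2)) ≤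
        potential (m + 1) R₁ r ^ 2 * r ^ (m + 1) := by
  set W := potential (m + 1) R₁ with hW
  set p : ℝ → ℝ := fun r => 2 * W r * (r ^ (m + 1))⁻¹ + (m + 1) * W r ^ 2 * r⁻¹ with hp
  have hpm : MonotoneOn p (Icc R₁ (criticalRadius (m + 2) R₁)) := monotoneOn_slope m hR
  set κ : ℝ := p b / (m + 2) with hκ
  set f : ℝ → ℝ := fun r => W r ^ 2 * r ^ (m + 1) - κ * r ^ (m + 2) with hf
  have hder : ∀ r, 0 < r → HasDerivAt f (r ^ (m + 1) * (p r - p b)) r := by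
    intro r hr
    have hWr : HasDerivAt W (r ^ (m + 1))⁻¹ r := hasDerivAt_potential hR hr
    have h1 := (hWr.pow 2).mul (hasDerivAt_pow (m + 1) r)
    have h2 := (hasDerivAt_pow (m + 2) r).const_mul κ
    refine (h1.sub h2).congr_deriv ?_
    have e : m + 2 - 1 = m + 1 := rfl
    simp only [Nat.add_sub_cancel, hκ, hp, e, Pi.pow_apply]
    push_cast
    rw [pow_succ r m]
    field_simp
  have hcont : ∀ s : Set ℝ, s ⊆ Ioi 0 → ContinuousOn f s := fun s hs r hr =>
    (hder r (hs hr)).continuousAt.continuousWithinAt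
  refine ⟨κ, fun r hr => ?_⟩
  suffices f b ≤ f r by simp only [hf] at this; linarith
  rcases le_total b r with hbr | hrb
  · have : MonotoneOn f (Icc b r) := by
      refine monotoneOn_of_deriv_nonneg (convex_Icc _ _)
        (hcont _ fun x hx => hR.trans_le (hb.1.trans hx.1)) ?_ ?_ <;> intro x hx <;>
        rw [interior_Icc] at hx <;> have hx0 : 0 < x := hR.trans_le (hb.1.trans hx.1.le)
      · exact (hder x hx0).differentiableAt.differentiableWithinAt
      · rw [(hder x hx0).deriv]
        exact mul_nonneg (by positivity) (sub_nonneg.2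
          (hpm hb ⟨hb.1.trans hx.1.le, hx.2.le.trans hr.2⟩ hx.1.le))
    exact this ⟨le_rfl, hbr⟩ ⟨hbr, le_rfl⟩ hbr
  · have : AntitoneOn f (Icc r b) := by
      refine antitoneOn_of_deriv_nonpos (convex_Icc _ _)
        (hcont _ fun x hx => hR.trans_le (hr.1.trans hx.1)) ?_ ?_ <;> intro x hx <;>
        rw [interior_Icc] at hx <;> have hx0 : 0 < x := hR.trans_le (hr.1.trans hx.1.le)
      · exact (hder x hx0).differentiableAt.differentiableWithinAt
      · rw [(hder x hx0).deriv]
        exact mul_nonpos_of_nonneg_of_nonpos (by positivity) (sub_nonpos.2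
          (hpm ⟨hr.1.trans hx.1.le, hx.2.le.trans hb.2⟩ hb hx.2.le))
    exact this ⟨le_rfl, hrb⟩ ⟨hrb, le_rfl⟩ hrb

end Potential

/-! ### The weighted isoperimetric inequality and the energy of the radial function -/

/-- Among sets of equal measure, the integral is largest over one on which `h` is above a level
exceeded nowhere outside. -/
theorem setLIntegral_le_of_measure_eq {α : Type*} [MeasurableSpace α] {μ : Measure α}
    {A B : Set α} (hA : MeasurableSet A) (hB : MeasurableSet B) (hAB : μ A = μ B) (hfin : μ A ≠ ⊤)
    {h : α → ℝ≥0∞} (M : ℝ≥0∞) (hle : ∀ x ∈ B \ A, h x ≤ M) (hge : ∀ x ∈ A \ B, M ≤ h x) :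
    ∫⁻ x in B, h x ∂μ ≤ ∫⁻ x in A, h x ∂μ := by
  have hdiff : μ (B \ A) = μ (A \ B) := by
    have h1 := measure_inter_add_sdiff (μ := μ) A hB
    have h2 := measure_inter_add_sdiff (μ := μ) B hA
    rw [inter_comm] at h2
    have h3 : μ (A ∩ B) ≠ ⊤ := measure_ne_top_of_subset inter_subset_left hfin
    rw [← h1, ← h2] at hAB
    exact ((ENNReal.add_right_inj h3).1 hAB).symm
  calc ∫⁻ x in B, h x ∂μ = ∫⁻ x in B ∩ A, h x ∂μ + ∫⁻ x in B \ A, h x ∂μ :=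
        (lintegral_inter_add_sdiff h B hA).symm
    _ ≤ ∫⁻ x in B ∩ A, h x ∂μ + M * μ (B \ A) := by
        gcongr
        rw [← setLIntegral_const]
        exact setLIntegral_mono measurable_const hle
    _ = ∫⁻ x in A ∩ B, h x ∂μ + M * μ (A \ B) := by rw [hdiff, inter_comm]
    _ ≤ ∫⁻ x in A ∩ B, h x ∂μ + ∫⁻ x in A \ B, h x ∂μ := by
        gcongr
        rw [← setLIntegral_const]
        exact setLIntegral_mono' (hA.diff hB) hge
    _ = ∫⁻ x in A, h x ∂μ := lintegral_inter_add_sdiff h A hB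

section Shell

variable {E : Type*} [NormedAddCommGroup E] [InnerProductSpace ℝ E] [FiniteDimensional ℝ E]
  [MeasurableSpace E] [BorelSpace E] {R₁ R₂ : ℝ}

theorem integrableOn_sphere {f : E → ℝ} (hf : ContinuousOn f (sphere 0 1)) :
    IntegrableOn f (sphere 0 1) μHE[finrank ℝ E - 1] := by
  have : IsFiniteMeasure ((μHE[finrank ℝ E - 1] : Measure E).restrict (sphere 0 1)) :=
    ⟨by simpa using euclideanHausdorffMeasure_sphere_lt_top⟩
  obtain ⟨C, hC⟩ := (isCompact_sphere (0 : E) 1).exists_bound_of_continuousOn hf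
  refine Integrable.of_bound (hf.aestronglyMeasurable isClosed_sphere.measurableSet) C ?_
  filter_upwards [ae_restrict_mem isClosed_sphere.measurableSet] with x hx using hC x hx

theorem lintegral_polar_shell {c : ℝ≥0∞} (hc : IsPolarConstant E c) (hR₁ : 0 < R₁)
    {f : E → ℝ≥0∞} (hf : Measurable f) :
    c * ∫⁻ x in ball (0 : E) R₂ \ closedBall 0 R₁, f x =
      ∫⁻ θ in sphere (0 : E) 1, (∫⁻ r in Ioo R₁ R₂,
        ENNReal.ofReal (r ^ (finrank ℝ E - 1)) * f (r • θ)) ∂μHE[finrank ℝ E - 1] := by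
  have hA : MeasurableSet (ball (0 : E) R₂ \ closedBall 0 R₁) :=
    measurableSet_ball.diff measurableSet_closedBall
  rw [← lintegral_indicator hA, hc.lintegral_eq _ (hf.indicator hA)]
  refine setLIntegral_congr_fun isClosed_sphere.measurableSet fun θ hθ => ?_
  have hθ1 : ‖θ‖ = 1 := by simpa using hθ
  have h1 : ∀ r ∈ Ioi (0 : ℝ), ENNReal.ofReal (r ^ (finrank ℝ E - 1)) *
      (ball (0 : E) R₂ \ closedBall 0 R₁).indicator f (r • θ) = (Ioo R₁ R₂).indicator
        (fun r => ENNReal.ofReal (r ^ (finrank ℝ E - 1)) * f (r • θ)) r := by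
    intro r hr
    have hiff : r • θ ∈ ball (0 : E) R₂ \ closedBall 0 R₁ ↔ r ∈ Ioo R₁ R₂ := by
      simp [norm_smul, hθ1, abs_of_pos (show 0 < r from hr), and_comm]
    by_cases hr' : r ∈ Ioo R₁ R₂
    · rw [indicator_of_mem (hiff.2 hr'), indicator_of_mem hr']
    · rw [indicator_of_notMem (fun h => hr' (hiff.1 h)), indicator_of_notMem hr', mul_zero]
  rw [setLIntegral_congr_fun measurableSet_Ioi h1, lintegral_indicator measurableSet_Ioo,
    Measure.restrict_restrict measurableSet_Ioo, inter_eq_left.2]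
  exact fun r hr => hR₁.trans hr.1

/-- The Dirichlet energy of the radial harmonic function on a shell. -/
theorem energy_shell {c : ℝ≥0∞} (hc : IsPolarConstant E c) (hR₁ : 0 < R₁) (hR₂ : R₁ < R₂) :
    c * ∫⁻ x in ball (0 : E) R₂ \ closedBall 0 R₁,
        ENNReal.ofReal ((‖x‖ ^ (finrank ℝ E - 1))⁻¹ ^ 2) =
      ENNReal.ofReal (potential (finrank ℝ E - 1) R₁ R₂) *
        μHE[finrank ℝ E - 1] (sphere (0 : E) 1) := by
  rw [lintegral_polar_shell hc hR₁ (by fun_prop), ← setLIntegral_const]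
  refine setLIntegral_congr_fun isClosed_sphere.measurableSet fun θ hθ => ?_
  have hθ1 : ‖θ‖ = 1 := by simpa using hθ
  have hsub : Icc R₁ R₂ ⊆ Ioi 0 := fun r hr => hR₁.trans_le hr.1
  rw [potential, ← lintegral_Ioo_ofReal hR₂.le ((continuousOn_inv_pow _).mono hsub)
    fun r hr => inv_nonneg.2 (pow_nonneg (hsub hr).le _)]
  refine setLIntegral_congr_fun measurableSet_Ioo fun r hr => ?_
  have hr0 : 0 < r := hR₁.trans hr.1
  simp only [norm_smul, hθ1, mul_one, Real.norm_eq_abs, abs_of_pos hr0]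
  rw [← ENNReal.ofReal_mul (by positivity)]
  congr 1
  field_simp

/-- Among sets outside the ball of radius `R₁` of given volume, the shell has the largest integral
of the radially decreasing energy density of the radial harmonic function. -/
theorem energy_le {c : ℝ≥0∞} (hc : IsPolarConstant E c) (hR₁ : 0 < R₁) (hR₂ : R₁ < R₂)
    {Ω₀ : Set E} (h : IsConvexDomain Ω₀)
    (hvol : volume (ball (0 : E) R₂ \ closedBall 0 R₁) = volume (Ω₀ \ closedBall 0 R₁)) :
    c * ∫⁻ x in Ω₀ \ closedBall 0 R₁, ENNReal.ofReal ((‖x‖ ^ (finrank ℝ E - 1))⁻¹ ^ 2) ≤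
      ENNReal.ofReal (potential (finrank ℝ E - 1) R₁ R₂) *
        μHE[finrank ℝ E - 1] (sphere (0 : E) 1) := by
  rw [← energy_shell hc hR₁ hR₂]
  refine mul_le_mul_right ?_ c
  refine setLIntegral_le_of_measure_eq (measurableSet_ball.diff measurableSet_closedBall)
    (h.isOpen.measurableSet.diff measurableSet_closedBall) hvol
    (measure_ne_top_of_subset sdiff_subset measure_ball_lt_top.ne)
    (ENNReal.ofReal ((R₂ ^ (finrank ℝ E - 1))⁻¹ ^ 2)) (fun x hx => ?_) (fun x hx => ?_)
  · have hx2 : R₂ ≤ ‖x‖ := by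
      by_contra hlt
      exact hx.2 ⟨by simpa using hlt, hx.1.2⟩
    have hR0 : 0 < R₂ := hR₁.trans hR₂
    gcongr
  · have hx2 : ‖x‖ ≤ R₂ := by simpa using (mem_ball_zero_iff.1 hx.1.1).le
    have hx1 : 0 < ‖x‖ := by
      have : R₁ < ‖x‖ := by simpa using hx.1.2
      exact hR₁.trans this
    have hR0 : 0 < R₂ := hR₁.trans hR₂
    gcongr

variable [Nontrivial E]

theorem le_of_volume_ball_le {a b : ℝ} (hb : 0 ≤ b)
    (h : volume (ball (0 : E) a) ≤ volume (ball (0 : E) b)) : a ≤ b := by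
  by_contra! hlt
  rw [Measure.addHaar_ball _ _ (hb.trans hlt.le), Measure.addHaar_ball _ _ hb,
    ENNReal.mul_le_mul_iff_left (measure_ball_pos _ _ one_pos).ne' measure_ball_lt_top.ne,
    ENNReal.ofReal_le_ofReal_iff (by positivity)] at h
  exact absurd h (not_le.2 (pow_lt_pow_left₀ hlt hb finrank_pos.ne'))

/-- The weighted isoperimetric inequality: below the critical radius, `W² rᵈ` is a convex function
of the volume in each direction, so the sphere of the same volume has the smallest integral. -/
theorem measure_sphere_mul_le {c : ℝ≥0∞} (hc : IsPolarConstant E c) {m : ℕ}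
    (hm : finrank ℝ E = m + 2) (hR₁ : 0 < R₁) (hR₂ : R₁ < R₂)
    {Ω₀ : Set E} (h : IsConvexDomain Ω₀) (hhole : closedBall 0 R₁ ⊆ Ω₀)
    (hcrit : Ω₀ ⊆ ball 0 (criticalRadius (m + 2) R₁))
    (hvol : volume (ball (0 : E) R₂) = volume Ω₀) :
    μHE[finrank ℝ E - 1] (sphere (0 : E) 1) *
        ENNReal.ofReal (potential (m + 1) R₁ R₂ ^ 2 * R₂ ^ (m + 1)) ≤
      ∫⁻ x in frontier Ω₀, ENNReal.ofReal (potential (m + 1) R₁ ‖x‖ ^ 2)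
        ∂μHE[finrank ℝ E - 1] := by
  set Rc := criticalRadius (m + 2) R₁ with hRc
  set W := potential (m + 1) R₁ with hW
  have hd : finrank ℝ E - 1 = m + 1 := by omega
  have hmem : ∀ θ ∈ sphere (0 : E) 1, R₁ • θ ∈ Ω₀ := by
    intro θ hθ
    exact hhole (by simp [norm_smul, mem_sphere_zero_iff_norm.1 hθ, abs_of_pos hR₁])
  have hRcpos : 0 < Rc := by
    have := hcrit h.zero_mem
    simpa using this
  have hrad : ∀ θ ∈ sphere (0 : E) 1, radius Ω₀ θ ∈ Icc R₁ Rc := by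
    intro θ hθ
    have hθ0 := ne_zero_of_mem_sphere hθ
    refine ⟨((h.smul_mem_iff hθ0 hR₁.le).1 (hmem θ hθ)).le, ?_⟩
    by_contra! hlt
    have := hcrit ((h.smul_mem_iff hθ0 hRcpos.le).2 hlt)
    simp [norm_smul, mem_sphere_zero_iff_norm.1 hθ, abs_of_pos hRcpos] at this
  have hR₂c : R₂ ≤ Rc := le_of_volume_ball_le hRcpos.le (hvol ▸ measure_mono hcrit)
  obtain ⟨κ, hκ⟩ := exists_tangent_le m hR₁ (b := R₂) ⟨hR₂.le, hR₂c⟩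
  set ν : Measure E := (μHE[finrank ℝ E - 1] : Measure E).restrict (sphere 0 1) with hν
  have hνfin : IsFiniteMeasure ν := ⟨by simpa [hν] using euclideanHausdorffMeasure_sphere_lt_top⟩
  have hνu : ν univ = μHE[finrank ℝ E - 1] (sphere (0 : E) 1) := by simp [hν]
  have hae : ∀ᵐ θ ∂ν, θ ∈ sphere (0 : E) 1 := ae_restrict_mem isClosed_sphere.measurableSet
  have hρc : ContinuousOn (radius Ω₀) (sphere 0 1) := h.continuousOn_radius
  have hi1 : Integrable (fun θ => radius Ω₀ θ ^ (m + 2)) ν := integrableOn_sphere (hρc.pow _)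
  have hWρ : ContinuousOn (fun θ => W (radius Ω₀ θ)) (sphere 0 1) :=
    (continuousOn_potential hR₁).comp hρc fun θ hθ => hR₁.trans_le (hrad θ hθ).1
  have hi2 : Integrable (fun θ => W (radius Ω₀ θ) ^ 2 * radius Ω₀ θ ^ (m + 1)) ν :=
    integrableOn_sphere ((hWρ.pow 2).mul (hρc.pow _))
  -- `Ω₀` and the ball have the same volume in polar coordinates.
  have hmean : ∫ θ, radius Ω₀ θ ^ (m + 2) ∂ν = R₂ ^ (m + 2) * ν.real univ := by
    have hn0 : (0 : ℝ) < (m + 2 : ℕ) := by positivity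
    have h1 := h.polar_volume hc
    have h2 := (isConvexDomain_ball (E := E) (hR₁.trans hR₂)).polar_volume hc
    have h3 : ∫⁻ θ in sphere (0 : E) 1, ENNReal.ofReal (radius (ball (0 : E) R₂) θ ^ finrank ℝ E /
        finrank ℝ E) ∂μHE[finrank ℝ E - 1] = ∫⁻ _, ENNReal.ofReal (R₂ ^ (m + 2) / (m + 2 : ℕ)) ∂ν :=
      setLIntegral_congr_fun isClosed_sphere.measurableSet fun θ hθ => by
        simp only [radius_ball (hR₁.trans hR₂) (mem_sphere_zero_iff_norm.1 hθ), hm]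
    rw [hvol, h1, h3, ← hν, hm,
      ← ofReal_integral_eq_lintegral_ofReal (hi1.div_const _) (by
        filter_upwards [hae] with θ hθ
        have := hR₁.trans_le (hrad θ hθ).1
        exact div_nonneg (pow_nonneg this.le _) hn0.le),
      ← ofReal_integral_eq_lintegral_ofReal (integrable_const _)
        (ae_of_all _ fun _ => div_nonneg (pow_nonneg (hR₁.trans hR₂).le _) hn0.le),
      ENNReal.ofReal_eq_ofReal_iff
        (integral_nonneg_of_ae (by
          filter_upwards [hae] with θ hθ
          have := hR₁.trans_le (hrad θ hθ).1
          exact div_nonneg (pow_nonneg this.le _) hn0.le))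
        (integral_nonneg fun _ => div_nonneg (pow_nonneg (hR₁.trans hR₂).le _) hn0.le),
      integral_div, integral_const, smul_eq_mul] at h2
    field_simp at h2
    linarith
  have hJ : ν.real univ * (W R₂ ^ 2 * R₂ ^ (m + 1)) ≤
      ∫ θ, W (radius Ω₀ θ) ^ 2 * radius Ω₀ θ ^ (m + 1) ∂ν := by
    calc ν.real univ * (W R₂ ^ 2 * R₂ ^ (m + 1))
        = ∫ θ, (W R₂ ^ 2 * R₂ ^ (m + 1) + κ * (radius Ω₀ θ ^ (m + 2) - R₂ ^ (m + 2))) ∂ν := by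
          have hi3 : Integrable (fun θ => radius Ω₀ θ ^ (m + 2) - R₂ ^ (m + 2)) ν :=
            hi1.sub (integrable_const _)
          rw [integral_add (integrable_const _) (hi3.const_mul κ),
            integral_const_mul κ, integral_sub hi1 (integrable_const _), hmean,
            integral_const, integral_const, smul_eq_mul, smul_eq_mul]
          ring
      _ ≤ _ := by
          refine integral_mono_ae ((integrable_const _).add
            ((hi1.sub (integrable_const _)).const_mul κ)) hi2 ?_
          filter_upwards [hae] with θ hθ using hκ _ (hrad θ hθ)
  calc μHE[finrank ℝ E - 1] (sphere (0 : E) 1) * ENNReal.ofReal (W R₂ ^ 2 * R₂ ^ (m + 1))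
      = ENNReal.ofReal (ν.real univ * (W R₂ ^ 2 * R₂ ^ (m + 1))) := by
        rw [ENNReal.ofReal_mul measureReal_nonneg, ofReal_measureReal, hνu]
    _ ≤ ENNReal.ofReal (∫ θ, W (radius Ω₀ θ) ^ 2 * radius Ω₀ θ ^ (m + 1) ∂ν) :=
        ENNReal.ofReal_le_ofReal hJ
    _ = ∫⁻ θ, ENNReal.ofReal (W (radius Ω₀ θ) ^ 2 * radius Ω₀ θ ^ (m + 1)) ∂ν := by
        refine ofReal_integral_eq_lintegral_ofReal hi2 ?_
        filter_upwards [hae] with θ hθ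
        have := hR₁.trans_le (hrad θ hθ).1
        exact mul_nonneg (sq_nonneg _) (pow_nonneg this.le _)
    _ = ∫⁻ θ in sphere (0 : E) 1, ENNReal.ofReal (radius Ω₀ θ ^ (finrank ℝ E - 1)) *
          (Ioi (0 : ℝ)).indicator (fun r => ENNReal.ofReal (W r ^ 2)) (radius Ω₀ θ)
          ∂μHE[finrank ℝ E - 1] := by
        refine setLIntegral_congr_fun isClosed_sphere.measurableSet fun θ hθ => ?_
        have := hR₁.trans_le (hrad θ hθ).1
        rw [indicator_of_mem (show radius Ω₀ θ ∈ Ioi 0 from this), hd,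
          ← ENNReal.ofReal_mul (by positivity), mul_comm]
    _ ≤ ∫⁻ x in frontier Ω₀, (Ioi (0 : ℝ)).indicator (fun r => ENNReal.ofReal (W r ^ 2)) ‖x‖
          ∂μHE[finrank ℝ E - 1] := by
        refine h.lintegral_sphere_radius_le ?_
        rw [← piecewise_eq_indicator]
        exact ContinuousOn.measurable_piecewise
          (ENNReal.continuous_ofReal.comp_continuousOn ((continuousOn_potential hR₁).pow 2))
          continuousOn_const measurableSet_Ioi
    _ = _ := by
        refine setLIntegral_congr_fun isClosed_frontier.measurableSet fun x hx => ?_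
        have hx0 : x ≠ 0 := fun h0 => h.zero_notMem_frontier (h0 ▸ hx)
        rw [indicator_of_mem (show ‖x‖ ∈ Ioi 0 from norm_pos_iff.2 hx0)]

end Shell

/-! ### The Rayleigh quotient on a shell -/

theorem eLpNorm_two_sq {α F : Type*} [MeasurableSpace α] [NormedAddCommGroup F] (μ : Measure α)
    (f : α → F) : eLpNorm f 2 μ ^ 2 = ∫⁻ x, ENNReal.ofReal (‖f x‖ ^ 2) ∂μ := by
  have := eLpNorm_nnreal_pow_eq_lintegral (f := f) (μ := μ) (p := 2) two_ne_zero
  simp only [NNReal.coe_ofNat, ENNReal.rpow_ofNat, ENNReal.coe_ofNat] at this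
  rw [this]
  refine lintegral_congr fun x => ?_
  rw [ENNReal.ofReal_pow (norm_nonneg _), ofReal_norm]

/-- The weighted Cauchy–Schwarz inequality on a ray. -/
theorem sq_intervalIntegral_le (d : ℕ) {R₁ R₂ : ℝ} (hR₁ : 0 < R₁) (hR₂ : R₁ < R₂) {f : ℝ → ℝ}
    (hf : Continuous f) :
    (∫ r in R₁..R₂, f r) ^ 2 ≤ potential d R₁ R₂ * ∫ r in R₁..R₂, r ^ d * f r ^ 2 := by
  set W := potential d R₁ R₂ with hW
  have hWpos : 0 < W := potential_pos hR₁ hR₂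
  set U := ∫ r in R₁..R₂, f r with hU
  set J := ∫ r in R₁..R₂, r ^ d * f r ^ 2 with hJ
  have hi0 : IntervalIntegrable (fun r : ℝ => (r ^ d)⁻¹) volume R₁ R₂ :=
    intervalIntegrable_inv_pow d hR₁ (hR₁.trans hR₂)
  have hi1 : IntervalIntegrable f volume R₁ R₂ := hf.intervalIntegrable _ _
  have hi2 : IntervalIntegrable (fun r => r ^ d * f r ^ 2) volume R₁ R₂ :=
    (by fun_prop : Continuous fun r => r ^ d * f r ^ 2).intervalIntegrable _ _
  set t := U / W with ht
  have h0 : 0 ≤ ∫ r in R₁..R₂, (r ^ d * f r ^ 2 - 2 * t * f r + t ^ 2 * (r ^ d)⁻¹) := by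
    refine intervalIntegral.integral_nonneg hR₂.le fun r hr => ?_
    have hr0 : 0 < r ^ d := pow_pos (hR₁.trans_le hr.1) d
    have : r ^ d * f r ^ 2 - 2 * t * f r + t ^ 2 * (r ^ d)⁻¹ =
        (r ^ d)⁻¹ * (r ^ d * f r - t) ^ 2 := by field_simp; ring
    rw [this]
    positivity
  rw [intervalIntegral.integral_add (hi2.sub (hi1.const_mul _)) (hi0.const_mul _),
    intervalIntegral.integral_sub hi2 (hi1.const_mul _), intervalIntegral.integral_const_mul,
    intervalIntegral.integral_const_mul] at h0
  change 0 ≤ J - 2 * t * U + t ^ 2 * W at h0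
  have h1 : J - 2 * t * U + t ^ 2 * W = J - U ^ 2 / W := by rw [ht]; field_simp; ring
  rw [h1, sub_nonneg, div_le_iff₀ hWpos] at h0
  linarith

section Rayleigh

variable {n : ℕ} {R₁ R₂ : ℝ}

local notation "𝔼" => EuclideanSpace ℝ (Fin n)

theorem continuous_gradient {φ : 𝔼 → ℝ} (hφ : ContDiff ℝ 1 φ) : Continuous (gradient φ) :=
  (InnerProductSpace.toDual ℝ 𝔼).symm.continuous.comp (hφ.continuous_fderiv one_ne_zero)

/-- The fundamental theorem of calculus along the ray through `θ`, then Cauchy–Schwarz. -/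
theorem sq_le_ray {ψ : 𝔼 → ℝ} (hψ : ContDiff ℝ 1 ψ) (d : ℕ) (hR₁ : 0 < R₁) (hR₂ : R₁ < R₂)
    (h0 : ∀ x ∈ sphere (0 : 𝔼) R₁, ψ x = 0) {θ : 𝔼} (hθ : ‖θ‖ = 1) :
    ENNReal.ofReal (‖ψ (R₂ • θ)‖ ^ 2) ≤ ENNReal.ofReal (potential d R₁ R₂) *
      ∫⁻ r in Ioo R₁ R₂, ENNReal.ofReal (r ^ d) * ENNReal.ofReal (‖gradient ψ (r • θ)‖ ^ 2) := by
  have hgc := continuous_gradient hψ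
  set f : ℝ → ℝ := fun r => inner ℝ (gradient ψ (r • θ)) θ with hf
  have hfc : Continuous f := by fun_prop
  have hder : ∀ r : ℝ, HasDerivAt (fun r : ℝ => ψ (r • θ)) (f r) r := by
    intro r
    have h1 : HasGradientAt ψ (gradient ψ (r • θ)) (r • θ) :=
      (hψ.differentiable one_ne_zero _).hasGradientAt
    have h2 : HasDerivAt (fun r : ℝ => r • θ) θ r := by
      simpa using (hasDerivAt_id r).smul_const θ
    have := h1.hasFDerivAt.comp_hasDerivAt r h2
    exact this.congr_deriv (by simp [hf])
  have hFTC : ∫ r in R₁..R₂, f r = ψ (R₂ • θ) := by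
    rw [intervalIntegral.integral_eq_sub_of_hasDerivAt (fun r _ => hder r)
      (hfc.intervalIntegrable _ _), h0 (R₁ • θ) (by simp [norm_smul, hθ, abs_of_pos hR₁]), sub_zero]
  have hgn : Continuous fun r : ℝ => r ^ d * ‖gradient ψ (r • θ)‖ ^ 2 := by fun_prop
  have hle : ∫ r in R₁..R₂, r ^ d * f r ^ 2 ≤
      ∫ r in R₁..R₂, r ^ d * ‖gradient ψ (r • θ)‖ ^ 2 := by
    refine intervalIntegral.integral_mono_on hR₂.le
      ((by fun_prop : Continuous fun r => r ^ d * f r ^ 2).intervalIntegrable _ _)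
      (hgn.intervalIntegrable _ _) fun r hr => ?_
    have hr0 : 0 < r := hR₁.trans_le hr.1
    have h3 : |f r| ≤ ‖gradient ψ (r • θ)‖ := by
      have := abs_real_inner_le_norm (gradient ψ (r • θ)) θ
      rwa [hθ, mul_one] at this
    rw [← sq_abs (f r)]
    gcongr
  have hW0 : 0 ≤ potential d R₁ R₂ := potential_nonneg hR₁ hR₂.le
  calc ENNReal.ofReal (‖ψ (R₂ • θ)‖ ^ 2)
      ≤ ENNReal.ofReal (potential d R₁ R₂ *
          ∫ r in R₁..R₂, r ^ d * ‖gradient ψ (r • θ)‖ ^ 2) := by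
        refine ENNReal.ofReal_le_ofReal ?_
        rw [← hFTC, Real.norm_eq_abs, sq_abs]
        exact (sq_intervalIntegral_le d hR₁ hR₂ hfc).trans (mul_le_mul_of_nonneg_left hle hW0)
    _ = ENNReal.ofReal (potential d R₁ R₂) *
          ∫⁻ r in Ioo R₁ R₂, ENNReal.ofReal (r ^ d * ‖gradient ψ (r • θ)‖ ^ 2) := by
        rw [ENNReal.ofReal_mul hW0, lintegral_Ioo_ofReal hR₂.le hgn.continuousOn fun r hr =>
          mul_nonneg (pow_nonneg (hR₁.le.trans hr.1) _) (sq_nonneg _)]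
    _ = _ := by
        congr 1
        refine setLIntegral_congr_fun measurableSet_Ioo fun r hr => ?_
        exact ENNReal.ofReal_mul (pow_nonneg (hR₁.trans hr.1).le _)

/-- The reciprocal of the eigenvalue of the shell `R₁ < ‖x‖ < R₂`. -/
def shellConstant (n : ℕ) (c : ℝ≥0∞) (R₁ R₂ : ℝ) : ℝ≥0∞ :=
  c * ENNReal.ofReal (potential (n - 1) R₁ R₂ * R₂ ^ (n - 1))

theorem eLpNorm_sphere_le {c : ℝ≥0∞} (hc : IsPolarConstant 𝔼 c) (hR₁ : 0 < R₁) (hR₂ : R₁ < R₂)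
    {ψ : 𝔼 → ℝ} (hψ : ContDiff ℝ 1 ψ) (h0 : ∀ x ∈ sphere (0 : 𝔼) R₁, ψ x = 0) :
    eLpNorm ψ 2 (surfaceMeasure (sphere 0 R₂)) ^ 2 ≤ shellConstant n c R₁ R₂ *
      eLpNorm (gradient ψ) 2 (volume.restrict (ball 0 R₂ \ closedBall 0 R₁)) ^ 2 := by
  have hgc := continuous_gradient hψ
  have hψc := hψ.continuous
  have hR0 : 0 < R₂ := hR₁.trans hR₂
  have hpol := lintegral_polar_shell (R₂ := R₂) hc hR₁
    (f := fun x => ENNReal.ofReal (‖gradient ψ x‖ ^ 2)) (by fun_prop)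
  rw [finrank_euclideanSpace_fin] at hpol
  rw [eLpNorm_two_sq, eLpNorm_two_sq, surfaceMeasure, lintegral_sphere_eq hR0 _ (by fun_prop),
    shellConstant, mul_comm c, mul_assoc, hpol, mul_comm (potential _ _ _),
    ENNReal.ofReal_mul (by positivity), mul_assoc]
  refine mul_le_mul_right ?_ _
  rw [← lintegral_const_mul' _ _ ENNReal.ofReal_ne_top]
  exact setLIntegral_mono' isClosed_sphere.measurableSet fun θ hθ =>
    sq_le_ray hψ _ hR₁ hR₂ h0 (mem_sphere_zero_iff_norm.1 hθ)

/-- The trace inequality on the outer sphere of a shell, by applying `eLpNorm_sphere_le` to the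
product of `φ` and a cut-off function. -/
theorem exists_eLpNorm_trace_le {c : ℝ≥0∞} (hc : IsPolarConstant 𝔼 c) (hR₁ : 0 < R₁)
    (hR₂ : R₁ < R₂) : ∃ C : ℝ≥0∞, C ≠ ⊤ ∧ ∀ φ : 𝔼 → ℝ, ContDiff ℝ 1 φ →
      eLpNorm φ 2 (surfaceMeasure (sphere 0 R₂)) ^ 2 ≤ C *
        (eLpNorm φ 2 (volume.restrict (ball 0 R₂ \ closedBall 0 R₁)) +
        eLpNorm (gradient φ) 2 (volume.restrict (ball 0 R₂ \ closedBall 0 R₁))) ^ 2 := by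
  have hR0 : 0 < R₂ := hR₁.trans hR₂
  have hsq : 0 < R₂ ^ 2 - R₁ ^ 2 := by nlinarith
  set η : 𝔼 → ℝ := fun x => Real.smoothTransition ((‖x‖ ^ 2 - R₁ ^ 2) / (R₂ ^ 2 - R₁ ^ 2)) with hη
  have hηs : ContDiff ℝ 1 η :=
    Real.smoothTransition.contDiff.comp (((contDiff_norm_sq ℝ).sub contDiff_const).div_const _)
  have hη1 : ∀ x ∈ sphere (0 : 𝔼) R₂, η x = 1 := by
    intro x hx
    have : (‖x‖ ^ 2 - R₁ ^ 2) / (R₂ ^ 2 - R₁ ^ 2) = 1 := by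
      rw [mem_sphere_zero_iff_norm.1 hx, div_self hsq.ne']
    rw [hη]
    simp only [this, Real.smoothTransition.one]
  have hη0 : ∀ x ∈ sphere (0 : 𝔼) R₁, η x = 0 := by
    intro x hx
    simp [hη, mem_sphere_zero_iff_norm.1 hx]
  have hηg := continuous_gradient hηs
  obtain ⟨M, hM⟩ := (isCompact_closedBall (0 : 𝔼) R₂).exists_bound_of_continuousOn hηg.continuousOn
  have hKt : shellConstant n c R₁ R₂ ≠ ⊤ := ENNReal.mul_ne_top hc.ne_top ENNReal.ofReal_ne_top
  refine ⟨shellConstant n c R₁ R₂ * (ENNReal.ofReal M + 1) ^ 2,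
    ENNReal.mul_ne_top hKt (by finiteness), fun φ hφ => ?_⟩
  set μ := (volume : Measure 𝔼).restrict (ball 0 R₂ \ closedBall 0 R₁) with hμ
  have hφg := continuous_gradient hφ
  have hφc := hφ.continuous
  have hA : MeasurableSet (ball (0 : 𝔼) R₂ \ closedBall 0 R₁) :=
    measurableSet_ball.diff measurableSet_closedBall
  have hgrad : ∀ x, gradient (fun x => η x * φ x) x = η x • gradient φ x + φ x • gradient η x := by
    intro x
    have h1 := (hηs.differentiable one_ne_zero x).hasGradientAt
    have h2 := (hφ.differentiable one_ne_zero x).hasGradientAt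
    refine HasGradientAt.gradient ?_
    rw [hasGradientAt_iff_hasFDerivAt]
    refine (h1.hasFDerivAt.mul h2.hasFDerivAt).congr_fderiv ?_
    simp [map_add]
  have hle : eLpNorm (gradient fun x => η x * φ x) 2 μ ≤
      eLpNorm (gradient φ) 2 μ + ENNReal.ofReal M * eLpNorm φ 2 μ := by
    have e : (gradient fun x => η x * φ x) =
        (fun x => η x • gradient φ x) + fun x => φ x • gradient η x := by
      ext1 x; exact hgrad x
    rw [e]
    refine (eLpNorm_add_le (by fun_prop) (by fun_prop) one_le_two).trans (add_le_add ?_ ?_)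
    · refine eLpNorm_mono fun x => ?_
      rw [norm_smul]
      refine mul_le_of_le_one_left (norm_nonneg _) ?_
      rw [Real.norm_of_nonneg (Real.smoothTransition.nonneg _)]
      exact Real.smoothTransition.le_one _
    · refine eLpNorm_le_mul_eLpNorm_of_ae_le_mul ?_ 2
      filter_upwards [ae_restrict_mem hA] with x hx
      rw [norm_smul, mul_comm]
      exact mul_le_mul_of_nonneg_right (hM x (ball_subset_closedBall hx.1)) (norm_nonneg _)
  calc eLpNorm φ 2 (surfaceMeasure (sphere 0 R₂)) ^ 2
      = eLpNorm (fun x => η x * φ x) 2 (surfaceMeasure (sphere 0 R₂)) ^ 2 := by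
        congr 1
        refine eLpNorm_congr_ae ?_
        filter_upwards [ae_restrict_mem isClosed_sphere.measurableSet] with x hx
        rw [hη1 x hx, one_mul]
    _ ≤ shellConstant n c R₁ R₂ * eLpNorm (gradient fun x => η x * φ x) 2 μ ^ 2 :=
        eLpNorm_sphere_le hc hR₁ hR₂ (hηs.mul hφ) fun x hx => by rw [hη0 x hx, zero_mul]
    _ ≤ shellConstant n c R₁ R₂ *
          ((ENNReal.ofReal M + 1) * (eLpNorm φ 2 μ + eLpNorm (gradient φ) 2 μ)) ^ 2 := by
        gcongr
        refine hle.trans ?_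
        rw [mul_add, add_mul, add_mul, one_mul, one_mul, add_comm]
        exact add_le_add le_self_add le_add_self
    _ = _ := by rw [mul_pow]; ring

/-- Passage to the limit: the approximations vanishing on the inner sphere may differ from those
which define the trace, but the trace inequality identifies their limits on the outer sphere. -/
theorem eLpNorm_trace_le {c : ℝ≥0∞} (hc : IsPolarConstant 𝔼 c) (hR₁ : 0 < R₁) (hR₂ : R₁ < R₂)
    {v : 𝔼 → ℝ} {G : 𝔼 → 𝔼} {g : 𝔼 → ℝ}
    (hv : MemH1Vanishing (ball 0 R₂ \ closedBall 0 R₁) (sphere 0 R₁) v G)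
    (hg : HasTrace (ball 0 R₂ \ closedBall 0 R₁) (sphere 0 R₂) v G g) :
    eLpNorm g 2 (surfaceMeasure (sphere 0 R₂)) ^ 2 ≤ shellConstant n c R₁ R₂ *
      eLpNorm G 2 (volume.restrict (ball 0 R₂ \ closedBall 0 R₁)) ^ 2 := by
  set μ := (volume : Measure 𝔼).restrict (ball 0 R₂ \ closedBall 0 R₁) with hμ
  set ν := surfaceMeasure (sphere (0 : 𝔼) R₂) with hν
  obtain ⟨ψ, hψ, hψv, hψG⟩ := hv.approx
  obtain ⟨hgL, φ, hφ, ⟨hφv, hφG⟩, hφg⟩ := hg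
  obtain ⟨C, hC, hCle⟩ := exists_eLpNorm_trace_le hc hR₁ hR₂
  have hvm := hv.memH1.memLp.aestronglyMeasurable
  have hGm := hv.memH1.memLp_grad.aestronglyMeasurable
  have hψs : ∀ k, ContDiff ℝ 1 (ψ k) := fun k => (hψ k).1.1.of_le (by norm_num)
  have hφs : ∀ k, ContDiff ℝ 1 (φ k) := fun k => (hφ k).1.of_le (by norm_num)
  have hψc : ∀ k, Continuous (ψ k) := fun k => (hψs k).continuous
  have hφc : ∀ k, Continuous (φ k) := fun k => (hφs k).continuous
  have hψg : ∀ k, Continuous (gradient (ψ k)) := fun k => continuous_gradient (hψs k)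
  have hφgc : ∀ k, Continuous (gradient (φ k)) := fun k => continuous_gradient (hφs k)
  have hgsub : ∀ k x, gradient (φ k - ψ k) x = gradient (φ k) x - gradient (ψ k) x := by
    intro k x
    have h1 := ((hφs k).differentiable one_ne_zero x).hasGradientAt
    have h2 := ((hψs k).differentiable one_ne_zero x).hasGradientAt
    refine HasGradientAt.gradient ?_
    rw [hasGradientAt_iff_hasFDerivAt, map_sub]
    exact h1.hasFDerivAt.sub h2.hasFDerivAt
  set a : ℕ → ℝ≥0∞ := fun k => eLpNorm (fun x => φ k x - v x) 2 μ with ha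
  set b : ℕ → ℝ≥0∞ := fun k => eLpNorm (fun x => gradient (φ k) x - G x) 2 μ with hb
  set a' : ℕ → ℝ≥0∞ := fun k => eLpNorm (fun x => ψ k x - v x) 2 μ with ha'
  set b' : ℕ → ℝ≥0∞ := fun k => eLpNorm (fun x => gradient (ψ k) x - G x) 2 μ with hb'
  set e : ℕ → ℝ≥0∞ := fun k => eLpNorm (fun x => φ k x - g x) 2 ν with he
  set K : ℝ≥0∞ := shellConstant n c R₁ R₂ ^ (1 / 2 : ℝ) with hK
  set D : ℝ≥0∞ := C ^ (1 / 2 : ℝ) with hD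
  have sqrt_sq : ∀ t : ℝ≥0∞, (t ^ (1 / 2 : ℝ)) ^ 2 = t := by
    intro t
    rw [← ENNReal.rpow_natCast, ← ENNReal.rpow_mul]
    norm_num
  have hDt : D ≠ ⊤ := ENNReal.rpow_ne_top_of_nonneg (by norm_num) hC
  have hKt : K ≠ ⊤ := ENNReal.rpow_ne_top_of_nonneg (by norm_num)
    (ENNReal.mul_ne_top hc.ne_top ENNReal.ofReal_ne_top)
  have hdiff : ∀ k, eLpNorm (φ k - ψ k) 2 ν ≤ D * ((a k + a' k) + (b k + b' k)) := by
    intro k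
    rw [← ENNReal.pow_le_pow_left_iff two_ne_zero, mul_pow, sqrt_sq]
    refine (hCle _ ((hφs k).sub (hψs k))).trans ?_
    gcongr
    · have : φ k - ψ k = (fun x => φ k x - v x) - fun x => ψ k x - v x := by ext x; simp
      change eLpNorm (φ k - ψ k) 2 μ ≤ _
      rw [this]
      exact eLpNorm_sub_le ((hφc k).aestronglyMeasurable.sub hvm)
        ((hψc k).aestronglyMeasurable.sub hvm) one_le_two
    · have : gradient (φ k - ψ k) =
          (fun x => gradient (φ k) x - G x) - fun x => gradient (ψ k) x - G x := by
        ext1 x; simp [hgsub]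
      change eLpNorm (gradient (φ k - ψ k)) 2 μ ≤ _
      rw [this]
      exact eLpNorm_sub_le ((hφgc k).aestronglyMeasurable.sub hGm)
        ((hψg k).aestronglyMeasurable.sub hGm) one_le_two
  have hψK : ∀ k, eLpNorm (ψ k) 2 ν ≤ K * (b' k + eLpNorm G 2 μ) := by
    intro k
    have h1 : eLpNorm (ψ k) 2 ν ≤ K * eLpNorm (gradient (ψ k)) 2 μ := by
      rw [← ENNReal.pow_le_pow_left_iff two_ne_zero, mul_pow, sqrt_sq]
      refine eLpNorm_sphere_le hc hR₁ hR₂ (hψs k) fun x hx => ?_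
      by_contra hne
      have : x ∈ tsupport (ψ k) ∩ sphere 0 R₁ := ⟨subset_tsupport _ hne, hx⟩
      rw [(hψ k).2] at this
      exact this
    refine h1.trans ?_
    gcongr
    have : gradient (ψ k) = (fun x => gradient (ψ k) x - G x) + G := by ext1 x; simp
    conv_lhs => rw [this]
    exact eLpNorm_add_le ((hψg k).aestronglyMeasurable.sub hGm) hGm one_le_two
  have hbound : ∀ k, eLpNorm g 2 ν ≤
      e k + (D * ((a k + a' k) + (b k + b' k)) + K * (b' k + eLpNorm G 2 μ)) := by
    intro k
    have h1 : g = (φ k - ψ k + ψ k) - fun x => φ k x - g x := by ext x; simp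
    have hsub : AEStronglyMeasurable (φ k - ψ k) ν := ((hφc k).sub (hψc k)).aestronglyMeasurable
    calc eLpNorm g 2 ν = eLpNorm ((φ k - ψ k + ψ k) - fun x => φ k x - g x) 2 ν := by rw [← h1]
      _ ≤ eLpNorm (φ k - ψ k + ψ k) 2 ν + e k :=
          eLpNorm_sub_le (hsub.add (hψc k).aestronglyMeasurable)
            ((hφc k).aestronglyMeasurable.sub hgL.aestronglyMeasurable) one_le_two
      _ ≤ (eLpNorm (φ k - ψ k) 2 ν + eLpNorm (ψ k) 2 ν) + e k := by
          gcongr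
          exact eLpNorm_add_le hsub (hψc k).aestronglyMeasurable one_le_two
      _ ≤ _ := by
          rw [add_comm]
          gcongr
          · exact hdiff k
          · exact hψK k
  have hlim : Tendsto (fun k =>
      e k + (D * ((a k + a' k) + (b k + b' k)) + K * (b' k + eLpNorm G 2 μ))) atTop
      (𝓝 (0 + (D * ((0 + 0) + (0 + 0)) + K * (0 + eLpNorm G 2 μ)))) := by
    refine hφg.add (Tendsto.add ?_ ?_)
    · exact ENNReal.Tendsto.const_mul ((hφv.add hψv).add (hφG.add hψG)) (Or.inr hDt)
    · exact ENNReal.Tendsto.const_mul (hψG.add tendsto_const_nhds) (Or.inr hKt)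
  have hfin := ge_of_tendsto' hlim hbound
  simp only [add_zero, mul_zero, zero_add] at hfin
  calc eLpNorm g 2 ν ^ 2 ≤ (K * eLpNorm G 2 μ) ^ 2 := by gcongr
    _ = _ := by rw [mul_pow, sqrt_sq]

end Rayleigh

/-! ### The radial harmonic function as a competitor -/

/-- A smooth function vanishing for `t ≤ 1` and equal to `t` for `t ≥ 2`. -/
def softTruncation (t : ℝ) : ℝ := t * Real.smoothTransition (t - 1)

theorem contDiff_softTruncation : ContDiff ℝ ∞ softTruncation :=
  contDiff_id.mul (Real.smoothTransition.contDiff.comp (contDiff_id.sub contDiff_const))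

theorem softTruncation_of_le_one {t : ℝ} (ht : t ≤ 1) : softTruncation t = 0 := by
  rw [softTruncation, Real.smoothTransition.zero_of_nonpos (by linarith), mul_zero]

theorem softTruncation_of_two_le {t : ℝ} (ht : 2 ≤ t) : softTruncation t = t := by
  rw [softTruncation, Real.smoothTransition.one_of_one_le (by linarith), mul_one]

theorem abs_softTruncation_sub_le {t : ℝ} (ht : 0 ≤ t) : |softTruncation t - t| ≤ t := by
  have h1 := Real.smoothTransition.nonneg (t - 1)
  have h2 := Real.smoothTransition.le_one (t - 1)
  rw [softTruncation, abs_le]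
  constructor <;> nlinarith

theorem deriv_softTruncation_of_two_lt {t : ℝ} (ht : 2 < t) : deriv softTruncation t = 1 := by
  have : softTruncation =ᶠ[𝓝 t] id := by
    filter_upwards [Ioi_mem_nhds ht] with s hs using softTruncation_of_two_le (le_of_lt hs)
  rw [this.deriv_eq, deriv_id]

theorem exists_abs_deriv_softTruncation_sub_le :
    ∃ M : ℝ, ∀ t, |deriv softTruncation t - 1| ≤ M := by
  have hc : Continuous (deriv softTruncation) :=
    contDiff_softTruncation.continuous_deriv (by norm_num)
  obtain ⟨M, hM⟩ := (isCompact_Icc (a := (1 : ℝ)) (b := 2)).exists_bound_of_continuousOn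
    (f := fun t => deriv softTruncation t - 1) (hc.sub continuous_const).continuousOn
  refine ⟨max M 1, fun t => ?_⟩
  rcases lt_or_ge t 1 with h1 | h1
  · have : softTruncation =ᶠ[𝓝 t] fun _ => 0 := by
      filter_upwards [Iio_mem_nhds h1] with s hs using softTruncation_of_le_one (le_of_lt hs)
    rw [this.deriv_eq, deriv_const]
    simp
  rcases le_or_gt t 2 with h2 | h2
  · exact (hM t ⟨h1, h2⟩).trans (le_max_left _ _)
  · rw [deriv_softTruncation_of_two_lt h2]
    simp

/-- Bounded convergence in `L²` of a finite measure. -/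
theorem tendsto_eLpNorm_two_of_bounded {α F : Type*} [MeasurableSpace α] [NormedAddCommGroup F]
    {μ : Measure α} [IsFiniteMeasure μ] {f : ℕ → α → F} (C : ℝ)
    (hm : ∀ k, AEStronglyMeasurable (f k) μ) (hb : ∀ k, ∀ᵐ x ∂μ, ‖f k x‖ ≤ C)
    (hlim : ∀ᵐ x ∂μ, Tendsto (fun k => f k x) atTop (𝓝 0)) :
    Tendsto (fun k => eLpNorm (f k) 2 μ) atTop (𝓝 0) := by
  have h1 : Tendsto (fun k => ∫⁻ x, ENNReal.ofReal (‖f k x‖ ^ 2) ∂μ) atTop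
      (𝓝 (∫⁻ _, 0 ∂μ)) := by
    refine tendsto_lintegral_of_dominated_convergence' (fun _ => ENNReal.ofReal (C ^ 2))
      (fun k => ((hm k).norm.pow 2).aemeasurable.ennreal_ofReal) (fun k => ?_) ?_ ?_
    · filter_upwards [hb k] with x hx
      exact ENNReal.ofReal_le_ofReal (pow_le_pow_left₀ (norm_nonneg _) hx 2)
    · rw [lintegral_const]
      exact ENNReal.mul_ne_top ENNReal.ofReal_ne_top (measure_ne_top _ _)
    · filter_upwards [hlim] with x hx
      have : Tendsto (fun k => ENNReal.ofReal (‖f k x‖ ^ 2)) atTop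
          (𝓝 (ENNReal.ofReal (‖(0 : F)‖ ^ 2))) :=
        (ENNReal.continuous_ofReal.tendsto _).comp (hx.norm.pow 2)
      simpa using this
  have h2 := ((ENNReal.continuous_rpow_const (y := (1 / 2 : ℝ))).tendsto _).comp h1
  have h3 : ∀ k, (∫⁻ x, ENNReal.ofReal (‖f k x‖ ^ 2) ∂μ) ^ (1 / 2 : ℝ) = eLpNorm (f k) 2 μ := by
    intro k
    rw [← eLpNorm_two_sq, ← ENNReal.rpow_natCast, ← ENNReal.rpow_mul]
    norm_num
  simp only [Function.comp_def, h3] at h2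
  simpa using h2

section Competitor

variable {n : ℕ} {R₁ : ℝ}

local notation "𝔼" => EuclideanSpace ℝ (Fin n)

/-- The radial harmonic function vanishing on the sphere of radius `R₁`. -/
def radialPotential (n : ℕ) (R₁ : ℝ) (x : EuclideanSpace ℝ (Fin n)) : ℝ :=
  potential (n - 1) R₁ ‖x‖

/-- The gradient of `radialPotential`. -/
def radialField (n : ℕ) (x : EuclideanSpace ℝ (Fin n)) : EuclideanSpace ℝ (Fin n) :=
  ((‖x‖ ^ (n - 1))⁻¹ * ‖x‖⁻¹) • x

theorem norm_radialField {x : 𝔼} (hx : x ≠ 0) : ‖radialField n x‖ = (‖x‖ ^ (n - 1))⁻¹ := by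
  have : ‖x‖ ≠ 0 := norm_ne_zero_iff.2 hx
  rw [radialField, norm_smul, norm_mul, norm_inv, norm_inv, norm_pow, norm_norm]
  field_simp

theorem continuousAt_radialField {x : 𝔼} (hx : x ≠ 0) : ContinuousAt (radialField n) x := by
  have : ‖x‖ ≠ 0 := norm_ne_zero_iff.2 hx
  have h1 : ContinuousAt (fun x : 𝔼 => ‖x‖) x := continuous_norm.continuousAt
  exact ((h1.pow _).inv₀ (pow_ne_zero _ this)).mul (h1.inv₀ this) |>.smul continuousAt_id

theorem contDiffAt_radialPotential (hR : 0 < R₁) {x : 𝔼} (hx : x ≠ 0) :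
    ContDiffAt ℝ ∞ (radialPotential n R₁) x :=
  ((contDiffOn_potential hR).contDiffAt (Ioi_mem_nhds (norm_pos_iff.2 hx))).comp x
    (contDiffAt_norm ℝ hx)

theorem hasGradientAt_radialPotential (hR : 0 < R₁) {x : 𝔼} (hx : x ≠ 0) :
    HasGradientAt (radialPotential n R₁) (radialField n x) x := by
  have hn : 0 < ‖x‖ := norm_pos_iff.2 hx
  have h1 : HasFDerivAt (fun y : 𝔼 => ‖y‖) (InnerProductSpace.toDual ℝ 𝔼 (‖x‖⁻¹ • x)) x := by
    have h := (hasStrictFDerivAt_norm_sq x).hasFDerivAt.sqrt (by positivity)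
    have e : (fun y : 𝔼 => √(‖y‖ ^ 2)) = fun y => ‖y‖ := by
      ext y; exact Real.sqrt_sq (norm_nonneg y)
    rw [e, Real.sqrt_sq hn.le] at h
    refine h.congr_fderiv ?_
    ext y
    simp
    field_simp
  rw [hasGradientAt_iff_hasFDerivAt]
  refine ((hasDerivAt_potential hR hn).comp_hasFDerivAt x h1).congr_fderiv ?_
  simp only [radialField, mul_smul, map_smul]

theorem eventually_radialPotential_lt (hR : 0 < R₁) {x : 𝔼} (hx : ‖x‖ ≤ R₁) {ε : ℝ} (hε : 0 < ε) :
    ∀ᶠ y in 𝓝 x, radialPotential n R₁ y < ε := by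
  rcases eq_or_ne x 0 with rfl | h0
  · filter_upwards [ball_mem_nhds (0 : 𝔼) hR] with y hy
    exact (potential_nonpos (norm_nonneg y) (mem_ball_zero_iff.1 hy).le).trans_lt hε
  · exact (contDiffAt_radialPotential hR h0).continuousAt.eventually_lt_const
      ((potential_nonpos (norm_nonneg x) hx).trans_lt hε)

/-- Smooth approximations of `radialPotential`, vanishing near the ball of radius `R₁`. -/
def approxPotential (R₁ : ℝ) (χ : EuclideanSpace ℝ (Fin n) → ℝ) (k : ℕ)
    (x : EuclideanSpace ℝ (Fin n)) : ℝ :=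
  χ x * ((k + 1 : ℝ)⁻¹ * softTruncation ((k + 1) * radialPotential n R₁ x))

theorem approxPotential_eventuallyEq_zero (hR : 0 < R₁) (χ : 𝔼 → ℝ) (k : ℕ) {x : 𝔼}
    (hx : ‖x‖ ≤ R₁) : approxPotential R₁ χ k =ᶠ[𝓝 x] 0 := by
  have hk : (0 : ℝ) < k + 1 := by positivity
  filter_upwards [eventually_radialPotential_lt hR hx (inv_pos.2 hk)] with y hy
  have : (k + 1) * radialPotential n R₁ y ≤ 1 := by
    have := mul_le_mul_of_nonneg_left hy.le hk.le
    rwa [mul_inv_cancel₀ hk.ne'] at this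
  rw [approxPotential, softTruncation_of_le_one this]
  simp

theorem isTestFunction_approxPotential (hR : 0 < R₁) {χ : 𝔼 → ℝ} (hχ : IsTestFunction χ) (k : ℕ) :
    IsTestFunction (approxPotential R₁ χ k) := by
  refine ⟨contDiff_iff_contDiffAt.2 fun x => ?_, hχ.2.mul_right⟩
  rcases eq_or_ne x 0 with rfl | h0
  · exact contDiffAt_const.congr_of_eventuallyEq
      (approxPotential_eventuallyEq_zero hR χ k (by simpa using hR.le))
  · exact hχ.1.contDiffAt.mul (contDiffAt_const.mul (contDiff_softTruncation.contDiffAt.comp x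
      (contDiffAt_const.mul (contDiffAt_radialPotential hR h0))))

theorem tsupport_approxPotential (hR : 0 < R₁) (χ : 𝔼 → ℝ) (k : ℕ) :
    tsupport (approxPotential R₁ χ k) ∩ sphere 0 R₁ = ∅ := by
  refine eq_empty_of_forall_notMem fun x hx => ?_
  exact notMem_tsupport_iff_eventuallyEq.2 (approxPotential_eventuallyEq_zero hR χ k
    (mem_sphere_zero_iff_norm.1 hx.2).le) hx.1

theorem gradient_approxPotential (hR : 0 < R₁) {χ : 𝔼 → ℝ} (k : ℕ) {x : 𝔼}
    (hx0 : x ≠ 0) (hx : χ =ᶠ[𝓝 x] 1) : gradient (approxPotential R₁ χ k) x =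
      deriv softTruncation ((k + 1) * radialPotential n R₁ x) • radialField n x := by
  have hk : (k + 1 : ℝ) ≠ 0 := by positivity
  have heq : approxPotential R₁ χ k =ᶠ[𝓝 x]
      fun y => (k + 1 : ℝ)⁻¹ * softTruncation ((k + 1) * radialPotential n R₁ y) := by
    filter_upwards [hx] with y hy
    rw [approxPotential, hy, Pi.one_apply, one_mul]
  refine HasGradientAt.gradient ?_
  rw [hasGradientAt_iff_hasFDerivAt]
  refine HasFDerivAt.congr_of_eventuallyEq ?_ heq
  have h1 := (hasGradientAt_radialPotential hR hx0).hasFDerivAt.const_mul (k + 1 : ℝ)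
  have h2 := (contDiff_softTruncation.differentiable (by norm_num)
    ((k + 1) * radialPotential n R₁ x)).hasDerivAt
  refine ((h2.comp_hasFDerivAt x h1).const_mul (k + 1 : ℝ)⁻¹).congr_fderiv ?_
  rw [map_smul, smul_smul, smul_smul]
  congr 1
  field_simp

theorem hasWeakGradient_radialPotential (hR : 0 < R₁) {Ω : Set 𝔼} (h0 : (0 : 𝔼) ∉ Ω) :
    HasWeakGradient Ω (radialPotential n R₁) (radialField n) := by
  intro φ hφ hsupp
  have hne : ∀ x ∈ tsupport φ, x ≠ 0 := fun x hx h => h0 (h ▸ hsupp hx)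
  have hφ1 : ContDiff ℝ 1 φ := hφ.1.of_le (by norm_num)
  have hgc := continuous_gradient hφ1
  have hgs : tsupport (gradient φ) ⊆ tsupport φ := by
    refine closure_minimal (fun x hx => ?_) (isClosed_tsupport φ)
    by_contra hx'
    refine hx ?_
    rw [gradient, fderiv_of_notMem_tsupport ℝ hx', map_zero]
  have hWc : ∀ x ∈ tsupport φ, ContinuousAt (radialPotential n R₁) x := fun x hx =>
    (contDiffAt_radialPotential hR (hne x hx)).continuousAt
  have hi1 : Integrable (fun x => radialPotential n R₁ x • gradient φ x) := by
    refine Continuous.integrable_of_hasCompactSupport ?_ (hφ.2.mono'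
      ((subset_tsupport _).trans ((tsupport_smul_subset_right _ _).trans hgs)))
    refine continuous_of_tsupport fun x hx => ?_
    exact (hWc x (hgs (tsupport_smul_subset_right _ _ hx))).smul hgc.continuousAt
  have hi2 : Integrable (fun x => φ x • radialField n x) := by
    refine Continuous.integrable_of_hasCompactSupport ?_ (hφ.2.mono'
      ((subset_tsupport _).trans (tsupport_smul_subset_left _ _)))
    refine continuous_of_tsupport fun x hx => ?_
    exact hφ.1.continuous.continuousAt.smul
      (continuousAt_radialField (hne x (tsupport_smul_subset_left _ _ hx)))
  have hi3 : Integrable (fun x => radialPotential n R₁ x * φ x) := by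
    refine Continuous.integrable_of_hasCompactSupport ?_ (hφ.2.mono'
      ((subset_tsupport _).trans tsupport_mul_subset_right))
    refine continuous_of_tsupport fun x hx => ?_
    exact (hWc x (tsupport_mul_subset_right hx)).mul hφ.1.continuous.continuousAt
  rw [setIntegral_eq_integral_of_forall_compl_eq_zero, setIntegral_eq_integral_of_forall_compl_eq_zero]
  rotate_left
  · intro x hx
    rw [image_eq_zero_of_notMem_tsupport fun h => hx (hsupp h), zero_smul]
  · intro x hx
    rw [image_eq_zero_of_notMem_tsupport fun h => hx (hsupp (hgs h)), smul_zero]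
  refine ext_inner_left ℝ fun v => ?_
  rw [inner_neg_right, ← integral_inner hi1, ← integral_inner hi2]
  have e1 : ∀ x, inner ℝ v (radialPotential n R₁ x • gradient φ x) =
      ContinuousLinearMap.mul ℝ ℝ (radialPotential n R₁ x) (fderiv ℝ φ x v) := by
    intro x
    rw [inner_smul_right, real_inner_comm, ← InnerProductSpace.toDual_apply_apply (𝕜 := ℝ),
      toDual_gradient, ContinuousLinearMap.mul_apply']
  have e2 : ∀ x, inner ℝ v (φ x • radialField n x) = ContinuousLinearMap.mul ℝ ℝ
      (InnerProductSpace.toDual ℝ 𝔼 (radialField n x) v) (φ x) := by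
    intro x
    rw [inner_smul_right, real_inner_comm, InnerProductSpace.toDual_apply_apply,
      ContinuousLinearMap.mul_apply', mul_comm]
  have hj1 := hi1.const_inner (𝕜 := ℝ) v
  have hj2 := hi2.const_inner (𝕜 := ℝ) v
  simp only [e1, e2] at hj1 hj2 ⊢
  exact integral_bilinear_hasFDerivAt_right_eq_neg_left_of_integrable hj2 hj1 hi3
    (fun x hx => (hasGradientAt_radialPotential hR (hne x hx)).hasFDerivAt)
    (fun x _ => (hφ1.differentiable one_ne_zero x).hasFDerivAt)

end Competitor

section Admissible

variable {n : ℕ} {R₁ : ℝ}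

local notation "𝔼" => EuclideanSpace ℝ (Fin n)

/-- The radial potential is admissible: the smooth compactly supported approximations, which vanish
near the hole, converge to it in `H¹` and in `L²` of the boundary, by dominated convergence. -/
theorem radialPotential_competitor {Ω₀ : Set 𝔼} (h : IsConvexDomain Ω₀) (hR₁ : 0 < R₁)
    (hhole : closedBall 0 R₁ ⊆ Ω₀) :
    MemH1Vanishing (Ω₀ \ closedBall 0 R₁) (sphere 0 R₁) (radialPotential n R₁) (radialField n) ∧
    HasTrace (Ω₀ \ closedBall 0 R₁) (frontier Ω₀) (radialPotential n R₁) (radialField n)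
      (radialPotential n R₁) := by
  obtain ⟨R, hR, hΩR⟩ := h.isBounded.subset_ball_lt 0 0
  set Ω := Ω₀ \ closedBall (0 : 𝔼) R₁ with hΩ
  set V := radialPotential n R₁ with hV
  set μ := (volume : Measure 𝔼).restrict Ω with hμ
  set ν := surfaceMeasure (frontier Ω₀) with hν
  have hΩm : MeasurableSet Ω := h.isOpen.measurableSet.diff measurableSet_closedBall
  have hμfin : IsFiniteMeasure μ := ⟨by
    rw [hμ, Measure.restrict_apply_univ]
    exact (measure_mono (sdiff_subset.trans hΩR)).trans_lt measure_ball_lt_top⟩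
  have hνfin : IsFiniteMeasure ν := ⟨by
    rw [hν, surfaceMeasure, Measure.restrict_apply_univ]
    have := h.measure_frontier_lt_top
    rwa [finrank_euclideanSpace_fin] at this⟩
  have memΩ : ∀ x ∈ Ω, R₁ < ‖x‖ ∧ ‖x‖ ≤ R := fun x hx =>
    ⟨by simpa using hx.2, (mem_ball_zero_iff.1 (hΩR hx.1)).le⟩
  have memF : ∀ x ∈ frontier Ω₀, R₁ < ‖x‖ ∧ ‖x‖ ≤ R := by
    intro x hx
    constructor
    · by_contra! hle
      rw [h.isOpen.frontier_eq] at hx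
      exact hx.2 (hhole (by simpa using hle))
    · simpa using closure_minimal (hΩR.trans ball_subset_closedBall) isClosed_closedBall
        (frontier_subset_closure hx)
  have ne0 : ∀ x : 𝔼, R₁ < ‖x‖ → x ≠ 0 := fun x hx => norm_pos_iff.1 (hR₁.trans hx)
  have aeΩ : ∀ᵐ x ∂μ, R₁ < ‖x‖ ∧ ‖x‖ ≤ R := by
    filter_upwards [ae_restrict_mem hΩm] with x hx using memΩ x hx
  have aeF : ∀ᵐ x ∂ν, R₁ < ‖x‖ ∧ ‖x‖ ≤ R := by
    filter_upwards [ae_restrict_mem isClosed_frontier.measurableSet] with x hx using memF x hx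
  have hVc : ∀ x : 𝔼, R₁ < ‖x‖ → ContinuousAt V x := fun x hx =>
    (contDiffAt_radialPotential hR₁ (ne0 x hx)).continuousAt
  have hVμ : AEStronglyMeasurable V μ := ContinuousOn.aestronglyMeasurable
    (fun x hx => (hVc x (memΩ x hx).1).continuousWithinAt) hΩm
  have hVν : AEStronglyMeasurable V ν := ContinuousOn.aestronglyMeasurable
    (fun x hx => (hVc x (memF x hx).1).continuousWithinAt) isClosed_frontier.measurableSet
  have hGμ : AEStronglyMeasurable (radialField n) μ := ContinuousOn.aestronglyMeasurable
    (fun x hx => (continuousAt_radialField (ne0 x (memΩ x hx).1)).continuousWithinAt) hΩm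
  have hV0 : ∀ x : 𝔼, R₁ < ‖x‖ → 0 < V x := fun x hx => potential_pos hR₁ hx
  have hVb : ∀ x : 𝔼, R₁ < ‖x‖ ∧ ‖x‖ ≤ R → ‖V x‖ ≤ potential (n - 1) R₁ R := by
    intro x hx
    rw [Real.norm_of_nonneg (hV0 x hx.1).le]
    exact (strictMonoOn_potential hR₁).monotoneOn (hR₁.trans hx.1) hR hx.2
  have hGb : ∀ x : 𝔼, R₁ < ‖x‖ → ‖radialField n x‖ ≤ (R₁ ^ (n - 1))⁻¹ := by
    intro x hx
    rw [norm_radialField (ne0 x hx)]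
    gcongr
  have hVL : MemLp V 2 μ := MemLp.of_bound hVμ _ (aeΩ.mono hVb)
  have hGL : MemLp (radialField n) 2 μ :=
    MemLp.of_bound hGμ _ (aeΩ.mono fun x hx => hGb x hx.1)
  have hVLν : MemLp V 2 ν := MemLp.of_bound hVν _ (aeF.mono hVb)
  -- `χ` equals one on a ball containing `Ω₀`; for fixed `x` outside the hole the truncation is
  -- inactive as soon as `(k + 1) * V x > 2`.
  let χ : ContDiffBump (0 : 𝔼) := ⟨R, R + 1, hR, by linarith⟩
  have hχ : IsTestFunction (χ : 𝔼 → ℝ) := ⟨χ.contDiff, χ.hasCompactSupport⟩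
  set φ : ℕ → 𝔼 → ℝ := fun k => approxPotential R₁ χ k with hφ
  have hφt : ∀ k, IsTestFunction (φ k) := isTestFunction_approxPotential hR₁ hχ
  have hφc : ∀ k, Continuous (φ k) := fun k => (hφt k).1.continuous
  have hφg : ∀ k, Continuous (gradient (φ k)) := fun k =>
    continuous_gradient ((hφt k).1.of_le (by norm_num))
  have htend : ∀ x : 𝔼, R₁ < ‖x‖ → ∀ᶠ k : ℕ in atTop, 2 < (k + 1) * V x := by
    intro x hx
    have : Tendsto (fun k : ℕ => ((k : ℝ) + 1) * V x) atTop atTop :=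
      (tendsto_natCast_atTop_atTop.atTop_add tendsto_const_nhds).atTop_mul_const (hV0 x hx)
    exact this.eventually_gt_atTop 2
  have hφV : ∀ k, ∀ x : 𝔼, R₁ < ‖x‖ ∧ ‖x‖ ≤ R →
      φ k x = (k + 1 : ℝ)⁻¹ * softTruncation ((k + 1) * V x) := by
    intro k x hx
    have : χ x = 1 := χ.one_of_mem_closedBall (by simpa using hx.2)
    simp only [hφ, approxPotential, this, one_mul, hV]
  have hval : ∀ k, ∀ x : 𝔼, R₁ < ‖x‖ ∧ ‖x‖ ≤ R → ‖φ k x - V x‖ ≤ potential (n - 1) R₁ R := by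
    intro k x hx
    have hk : (0 : ℝ) < k + 1 := by positivity
    refine le_trans ?_ (hVb x hx)
    have e : φ k x - V x = (k + 1 : ℝ)⁻¹ * (softTruncation ((k + 1) * V x) - (k + 1) * V x) := by
      rw [hφV k x hx]; field_simp
    rw [e, norm_mul, Real.norm_of_nonneg (inv_pos.2 hk).le, Real.norm_of_nonneg (hV0 x hx.1).le,
      inv_mul_le_iff₀ hk, Real.norm_eq_abs]
    exact abs_softTruncation_sub_le (mul_pos hk (hV0 x hx.1)).le
  have hvalt : ∀ x : 𝔼, R₁ < ‖x‖ ∧ ‖x‖ ≤ R →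
      Tendsto (fun k => φ k x - V x) atTop (𝓝 0) := by
    intro x hx
    refine tendsto_const_nhds.congr' ?_
    filter_upwards [htend x hx.1] with k hk
    have hk' : (0 : ℝ) < k + 1 := by positivity
    rw [hφV k x hx, softTruncation_of_two_le hk.le]
    field_simp
    ring
  obtain ⟨M, hM⟩ := exists_abs_deriv_softTruncation_sub_le
  have hφG : ∀ k, ∀ x ∈ Ω, gradient (φ k) x - radialField n x =
      (deriv softTruncation ((k + 1) * V x) - 1) • radialField n x := by
    intro k x hx
    rw [sub_smul, one_smul, hφ, gradient_approxPotential hR₁ k (ne0 x (memΩ x hx).1)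
      (χ.eventuallyEq_one_of_mem_ball (hΩR hx.1))]
  have hTend : TendstoH1 Ω φ V (radialField n) := by
    constructor
    · exact tendsto_eLpNorm_two_of_bounded _ (fun k => (hφc k).aestronglyMeasurable.sub hVμ)
        (fun k => aeΩ.mono (hval k)) (aeΩ.mono hvalt)
    · refine tendsto_eLpNorm_two_of_bounded (M * (R₁ ^ (n - 1))⁻¹)
        (fun k => (hφg k).aestronglyMeasurable.sub hGμ) (fun k => ?_) ?_
      · filter_upwards [ae_restrict_mem hΩm] with x hx
        rw [hφG k x hx, norm_smul]
        exact mul_le_mul (hM _) (hGb x (memΩ x hx).1) (norm_nonneg _)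
          ((abs_nonneg _).trans (hM 0))
      · filter_upwards [ae_restrict_mem hΩm] with x hx
        refine tendsto_const_nhds.congr' ?_
        filter_upwards [htend x (memΩ x hx).1] with k hk
        rw [hφG k x hx, deriv_softTruncation_of_two_lt hk, sub_self, zero_smul]
  refine ⟨⟨⟨hVL, hGL, hasWeakGradient_radialPotential hR₁ fun h0 => ?_⟩, φ,
    fun k => ⟨hφt k, tsupport_approxPotential hR₁ χ k⟩, hTend⟩, hVLν, φ, hφt, hTend, ?_⟩
  · exact h0.2 (mem_closedBall_self hR₁.le)
  · exact tendsto_eLpNorm_two_of_bounded _ (fun k => (hφc k).aestronglyMeasurable.sub hVν)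
      (fun k => aeF.mono (hval k)) (aeF.mono hvalt)

end Admissible

/-! ### Comparison of the eigenvalues -/

section Comparison

variable {n : ℕ} {R₁ : ℝ}

local notation "𝔼" => EuclideanSpace ℝ (Fin n)

theorem nontrivial_euclideanSpace (hn : 2 ≤ n) : Nontrivial 𝔼 :=
  have : Nontrivial (Fin n) := Fin.nontrivial_iff_two_le.2 hn
  inferInstance

theorem integral_norm_sq_eq {α F : Type*} [MeasurableSpace α] [NormedAddCommGroup F]
    {μ : Measure α} {f : α → F} (hf : MemLp f 2 μ) :
    ∫ x, ‖f x‖ ^ 2 ∂μ = (eLpNorm f 2 μ ^ 2).toReal := by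
  rw [eLpNorm_two_sq, integral_eq_lintegral_of_nonneg_ae (ae_of_all _ fun x => sq_nonneg _)
    (hf.aestronglyMeasurable.norm.pow 2)]

theorem eLpNorm_sq_toReal_pos {Γ : Set 𝔼} {g : 𝔼 → ℝ} (hg : MemLp g 2 (surfaceMeasure Γ))
    (h0 : ¬ g =ᵐ[surfaceMeasure Γ] 0) : 0 < (eLpNorm g 2 (surfaceMeasure Γ) ^ 2).toReal := by
  refine ENNReal.toReal_pos (pow_ne_zero 2 fun h => h0 ?_) (ENNReal.pow_ne_top hg.eLpNorm_ne_top)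
  exact (eLpNorm_eq_zero_iff hg.aestronglyMeasurable two_ne_zero).1 h

/-- The quotients over which the infimum in `sigma1` is taken. -/
def rayleighQuotients (Ω ΓD ΓS : Set (EuclideanSpace ℝ (Fin n))) : Set ℝ :=
  {q : ℝ | ∃ (v : EuclideanSpace ℝ (Fin n) → ℝ)
    (G : EuclideanSpace ℝ (Fin n) → EuclideanSpace ℝ (Fin n))
    (g : EuclideanSpace ℝ (Fin n) → ℝ),
    MemH1Vanishing Ω ΓD v G ∧ ¬ (v =ᵐ[volume.restrict Ω] 0) ∧
    HasTrace Ω ΓS v G g ∧ ¬ (g =ᵐ[surfaceMeasure ΓS] 0) ∧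
    q = (∫ x in Ω, ‖G x‖ ^ 2) / (∫ x, g x ^ 2 ∂(surfaceMeasure ΓS))}

theorem bddBelow_rayleighQuotients (Ω ΓD ΓS : Set 𝔼) :
    BddBelow (rayleighQuotients Ω ΓD ΓS) := by
  refine ⟨0, ?_⟩
  rintro q ⟨v, G, g, -, -, -, -, rfl⟩
  exact div_nonneg (integral_nonneg fun _ => sq_nonneg _) (integral_nonneg fun _ => sq_nonneg _)

theorem radialPotential_mem_rayleighQuotients (hn : 2 ≤ n) {Ω₀ : Set 𝔼} (h : IsConvexDomain Ω₀)
    (hR₁ : 0 < R₁) (hhole : closedBall 0 R₁ ⊆ Ω₀)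
    (hvol : volume (Ω₀ \ closedBall (0 : 𝔼) R₁) ≠ 0) :
    (eLpNorm (radialField n) 2 (volume.restrict (Ω₀ \ closedBall 0 R₁)) ^ 2).toReal /
        (eLpNorm (radialPotential n R₁) 2 (surfaceMeasure (frontier Ω₀)) ^ 2).toReal ∈
      rayleighQuotients (Ω₀ \ closedBall 0 R₁) (sphere 0 R₁) (frontier Ω₀) ∧
    ¬ (radialPotential n R₁ =ᵐ[surfaceMeasure (frontier Ω₀)] 0) := by
  have := nontrivial_euclideanSpace hn
  obtain ⟨hv, hg⟩ := radialPotential_competitor h hR₁ hhole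
  have hg0 : ¬ (radialPotential n R₁ =ᵐ[surfaceMeasure (frontier Ω₀)] 0) := by
    intro hz
    have hpos := h.measure_frontier_pos
    rw [finrank_euclideanSpace_fin] at hpos
    have hF : ∀ᵐ x ∂(surfaceMeasure (frontier Ω₀)), x ∈ frontier Ω₀ :=
      ae_restrict_mem isClosed_frontier.measurableSet
    have hfalse : ∀ᵐ x ∂(surfaceMeasure (frontier Ω₀)), False := by
      filter_upwards [hz, hF] with x hx hxF
      have hx1 : R₁ < ‖x‖ := by
        by_contra! hle
        rw [h.isOpen.frontier_eq] at hxF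
        exact hxF.2 (hhole (by simpa using hle))
      exact (potential_pos (d := n - 1) hR₁ hx1).ne' hx
    have h0 := ae_iff.1 hfalse
    simp only [not_false_eq_true, ofPred_true, surfaceMeasure, Measure.restrict_apply_univ] at h0
    exact hpos.ne' h0
  refine ⟨⟨radialPotential n R₁, radialField n, radialPotential n R₁, hv, ?_, hg, hg0, ?_⟩, hg0⟩
  · intro hz
    have hΩm : MeasurableSet (Ω₀ \ closedBall (0 : 𝔼) R₁) :=
      h.isOpen.measurableSet.diff measurableSet_closedBall
    have hfalse : ∀ᵐ x ∂(volume.restrict (Ω₀ \ closedBall (0 : 𝔼) R₁)), False := by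
      filter_upwards [hz, ae_restrict_mem hΩm] with x hx hxΩ
      have hx1 : R₁ < ‖x‖ := by simpa using hxΩ.2
      exact (potential_pos (d := n - 1) hR₁ hx1).ne' hx
    have h0 := ae_iff.1 hfalse
    simp only [not_false_eq_true, ofPred_true, Measure.restrict_apply_univ] at h0
    exact hvol h0
  · rw [integral_norm_sq_eq hv.memH1.memLp_grad, ← integral_norm_sq_eq hg.1]
    simp only [Real.norm_eq_abs, sq_abs]

theorem shellConstant_toReal_pos {c : ℝ≥0∞} (hc : IsPolarConstant 𝔼 c) (hR₁ : 0 < R₁)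
    (hR₂ : R₁ < R₂) : 0 < (shellConstant n c R₁ R₂).toReal := by
  have : 0 < R₂ := hR₁.trans hR₂
  refine ENNReal.toReal_pos (mul_ne_zero hc.ne_zero ?_)
    (ENNReal.mul_ne_top hc.ne_top ENNReal.ofReal_ne_top)
  rw [ENNReal.ofReal_ne_zero_iff]
  exact mul_pos (potential_pos hR₁ hR₂) (by positivity)

theorem le_of_mem_rayleighQuotients_shell {c : ℝ≥0∞} (hc : IsPolarConstant 𝔼 c) (hR₁ : 0 < R₁)
    (hR₂ : R₁ < R₂) {q : ℝ}
    (hq : q ∈ rayleighQuotients (ball (0 : 𝔼) R₂ \ closedBall 0 R₁) (sphere 0 R₁) (sphere 0 R₂)) :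
    (shellConstant n c R₁ R₂).toReal⁻¹ ≤ q := by
  obtain ⟨v, G, g, hv, -, hg, hg0, rfl⟩ := hq
  have hK := shellConstant_toReal_pos hc hR₁ hR₂
  have hD := eLpNorm_sq_toReal_pos hg.1 hg0
  have hle := ENNReal.toReal_mono (ENNReal.mul_ne_top
    (ENNReal.mul_ne_top hc.ne_top ENNReal.ofReal_ne_top)
    (ENNReal.pow_ne_top hv.memH1.memLp_grad.eLpNorm_ne_top)) (eLpNorm_trace_le hc hR₁ hR₂ hv hg)
  rw [ENNReal.toReal_mul] at hle
  have e : ∫ x, g x ^ 2 ∂(surfaceMeasure (sphere 0 R₂)) =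
      (eLpNorm g 2 (surfaceMeasure (sphere 0 R₂)) ^ 2).toReal := by
    rw [← integral_norm_sq_eq hg.1]
    simp only [Real.norm_eq_abs, sq_abs]
  rw [integral_norm_sq_eq hv.memH1.memLp_grad, e, le_div_iff₀ hD, inv_mul_le_iff₀ hK]
  exact hle

/-- The Rayleigh quotient of the radial potential on `Ω₀` is at most the one on the shell, in a form
free of division. -/
theorem shellConstant_mul_energy_le {c : ℝ≥0∞} (hn : 2 ≤ n) (hc : IsPolarConstant 𝔼 c)
    (hR₁ : 0 < R₁) (hR₂ : R₁ < R₂) {Ω₀ : Set 𝔼} (h : IsConvexDomain Ω₀)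
    (hhole : closedBall 0 R₁ ⊆ Ω₀) (hcrit : Ω₀ ⊆ ball 0 (criticalRadius n R₁))
    (hvol : volume (ball (0 : 𝔼) R₂ \ closedBall 0 R₁) = volume (Ω₀ \ closedBall 0 R₁)) :
    shellConstant n c R₁ R₂ *
        eLpNorm (radialField n) 2 (volume.restrict (Ω₀ \ closedBall 0 R₁)) ^ 2 ≤
      eLpNorm (radialPotential n R₁) 2 (surfaceMeasure (frontier Ω₀)) ^ 2 := by
  have := nontrivial_euclideanSpace hn
  obtain ⟨m, rfl⟩ := Nat.exists_eq_add_of_le' hn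
  have hball : volume (ball (0 : EuclideanSpace ℝ (Fin (m + 2))) R₂) = volume Ω₀ := by
    rw [← measure_inter_add_sdiff (ball _ R₂) measurableSet_closedBall,
      ← measure_inter_add_sdiff Ω₀ measurableSet_closedBall, hvol, inter_eq_right.2 hhole,
      inter_eq_right.2 (closedBall_subset_ball hR₂)]
  have hE := energy_le hc hR₁ hR₂ h hvol
  have hB := measure_sphere_mul_le hc finrank_euclideanSpace_fin hR₁ hR₂ h hhole hcrit hball
  rw [finrank_euclideanSpace_fin] at hE hB
  have hW := potential_pos (d := m + 1) hR₁ hR₂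
  have hR0 : 0 < R₂ := hR₁.trans hR₂
  have hN : eLpNorm (radialField (m + 2)) 2 (volume.restrict (Ω₀ \ closedBall 0 R₁)) ^ 2 =
      ∫⁻ x in Ω₀ \ closedBall 0 R₁, ENNReal.ofReal ((‖x‖ ^ (m + 2 - 1))⁻¹ ^ 2) := by
    rw [eLpNorm_two_sq]
    refine setLIntegral_congr_fun (h.isOpen.measurableSet.diff measurableSet_closedBall)
      fun x hx => ?_
    have hx1 : R₁ < ‖x‖ := by simpa using hx.2
    simp only [norm_radialField (norm_pos_iff.1 (hR₁.trans hx1))]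
  rw [hN, eLpNorm_two_sq, shellConstant, mul_right_comm]
  have e : m + 2 - 1 = m + 1 := rfl
  rw [e] at hE hB ⊢
  calc c * (∫⁻ x in Ω₀ \ closedBall 0 R₁, ENNReal.ofReal ((‖x‖ ^ (m + 1))⁻¹ ^ 2)) *
        ENNReal.ofReal (potential (m + 1) R₁ R₂ * R₂ ^ (m + 1))
      ≤ (ENNReal.ofReal (potential (m + 1) R₁ R₂) *
          μHE[m + 1] (sphere (0 : EuclideanSpace ℝ (Fin (m + 2))) 1)) *
        ENNReal.ofReal (potential (m + 1) R₁ R₂ * R₂ ^ (m + 1)) := by gcongr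
    _ = μHE[m + 1] (sphere (0 : EuclideanSpace ℝ (Fin (m + 2))) 1) *
        ENNReal.ofReal (potential (m + 1) R₁ R₂ ^ 2 * R₂ ^ (m + 1)) := by
        rw [pow_two, mul_assoc (potential (m + 1) R₁ R₂) (potential (m + 1) R₁ R₂),
          ENNReal.ofReal_mul (q := potential (m + 1) R₁ R₂ * R₂ ^ (m + 1)) hW.le]
        ring
    _ ≤ _ := hB
    _ = _ := by
        simp only [surfaceMeasure, radialPotential, e, Real.norm_eq_abs, sq_abs]

end Comparison

end SteklovDirichlet

end

open SteklovDirichlet in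
theorem theorem1p1 (n : ℕ) (hn : 2 ≤ n) (R₁ : ℝ) (hR₁ : 0 < R₁)
    (Ω₀ : Set (EuclideanSpace ℝ (Fin n)))
    (hopen : IsOpen Ω₀) (hbdd : Bornology.IsBounded Ω₀) (hconv : Convex ℝ Ω₀)
    (hhole : Metric.closedBall 0 R₁ ⊆ Ω₀)
    (hcrit : Ω₀ ⊆ Metric.ball 0 (SteklovDirichlet.criticalRadius n R₁))
    (R₂ : ℝ) (hR₂ : R₁ < R₂)
    (hvol : volume (SteklovDirichlet.sphericalShell n R₁ R₂) =
      volume (Ω₀ \ Metric.closedBall 0 R₁)) :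
    SteklovDirichlet.sigma1 (Ω₀ \ Metric.closedBall 0 R₁) (Metric.sphere 0 R₁) (frontier Ω₀) ≤
      SteklovDirichlet.sigma1 (SteklovDirichlet.sphericalShell n R₁ R₂)
        (Metric.sphere 0 R₁) (Metric.sphere 0 R₂) := by
  have := nontrivial_euclideanSpace hn
  have h : IsConvexDomain Ω₀ := ⟨hopen, hbdd, hconv, hhole (Metric.mem_closedBall_self hR₁.le)⟩
  have hR0 : 0 < R₂ := hR₁.trans hR₂
  obtain ⟨c, hc0, hct, hc⟩ := exists_polarCoord (E := EuclideanSpace ℝ (Fin n))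
  have hc : IsPolarConstant (EuclideanSpace ℝ (Fin n)) c := ⟨hc0, hct, hc⟩
  have hshell : sphericalShell n R₁ R₂ = Metric.ball 0 R₂ \ Metric.closedBall 0 R₁ := by
    ext x
    simp [sphericalShell, and_comm]
  rw [hshell] at hvol ⊢
  have hvol0 : volume (Metric.ball (0 : EuclideanSpace ℝ (Fin n)) R₂ \
      Metric.closedBall 0 R₁) ≠ 0 := by
    obtain ⟨x, hx⟩ := (NormedSpace.sphere_nonempty (x := (0 : EuclideanSpace ℝ (Fin n)))
      (r := (R₁ + R₂) / 2)).2 (by linarith)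
    rw [mem_sphere_zero_iff_norm] at hx
    refine (Metric.isOpen_ball.sdiff Metric.isClosed_closedBall).measure_ne_zero _
      ⟨x, mem_ball_zero_iff.2 (by linarith), fun hx' => ?_⟩
    have := mem_closedBall_zero_iff.1 hx'
    linarith
  have hK := shellConstant_toReal_pos hc hR₁ hR₂
  obtain ⟨hq, hg0⟩ := radialPotential_mem_rayleighQuotients hn h hR₁ hhole (hvol ▸ hvol0)
  obtain ⟨hq', -⟩ := radialPotential_mem_rayleighQuotients hn (isConvexDomain_ball hR0) hR₁
    (Metric.closedBall_subset_ball hR₂) hvol0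
  rw [frontier_ball _ hR0.ne'] at hq'
  obtain ⟨hv, hg⟩ := radialPotential_competitor h hR₁ hhole
  have hD := eLpNorm_sq_toReal_pos hg.1 hg0
  have hle := ENNReal.toReal_mono (ENNReal.pow_ne_top hg.1.eLpNorm_ne_top)
    (shellConstant_mul_energy_le hn hc hR₁ hR₂ h hhole hcrit hvol)
  rw [ENNReal.toReal_mul] at hle
  calc sigma1 (Ω₀ \ Metric.closedBall 0 R₁) (Metric.sphere 0 R₁) (frontier Ω₀)
      ≤ _ := csInf_le (bddBelow_rayleighQuotients _ _ _) hq
    _ ≤ (shellConstant n c R₁ R₂).toReal⁻¹ := by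
        rw [div_le_iff₀ hD, le_inv_mul_iff₀ hK]
        exact hle
    _ ≤ _ := le_csInf ⟨_, hq'⟩ fun q hq => le_of_mem_rayleighQuotients_shell hc hR₁ hR₂ hq
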